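/- **Algebras.** A GMTL-algebra is a commutative integral distributive residuated lattice $(A,\wedge,\vee,\cdot,\to,1)$ (so $1$ is the monoid unit and the greatest element, and $ab\le c\iff b\le a\to c$) satisfying $(a\to b)\vee(b\to a)=1$; an MTL-algebra is a GMTL-algebra with a designated least element $0$, and then $\neg a:=a\to0$, $a\oplus b:=\neg(\neg a\cdot\neg b)$. An SBP-algebra is an MTL-algebra satisfying $\neg(a^2)\to(\neg\neg a\to a)=1$ and $(a\oplus a)^2=a^2\oplus a^2$. An external join of a Boolean algebra $B$ and a GMTL-algebra $A$ is a map $(u,x)\mapsto u\vee_e x=\nu_u(x)$, $B\times A\to A$, such that each $\nu_u$ is an endomorphism of $A$; $u\mapsto\nu_u(x)$ preserves $\wedge,\vee$ for each $x$; $\nu_0=\mathrm{id}$, $\nu_1\equiv1$; and $\nu_u(x)\vee\nu_v(y)=\nu_{u\vee v}(x\vee y)=\nu_u(\nu_v(x\vee y))$. **Extended Priestley duals.** The extended Priestley dual of an MTL-algebra $L$ is the set of its proper prime filters, ordered by inclusion, with the topology generated by the sets $\varphi(a)=\{\mathfrak p: a\in\mathfrak p\}$ and their complements, the ternary relation $R(\mathfrak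 a,\mathfrak b,\mathfrak c)\iff\{c:\exists a\in\mathfrak a,\,b\in\mathfrak b,\ ab\le c\}\subseteq\mathfrak c$, and the distinguished set $E=\{\mathfrak p:1\in\mathfrak p\}$. **Spaces.** For a ternary relation $R$ on $X$ put $R[U,V,-]=\{z:\exists x\in U,\,y\in V,\ R(x,y,z)\}$ and $R[z,V,-]=R[\{z\},V,-]$, $R[U,z,-]=R[U,\{z\},-]$. An unpointed residuated space is a Priestley space $X$ with a ternary relation $R$ and a clopen up-set $E$ such that, for all points and all clopen up-sets $U,V$: (1) $\exists u\,(R(x,y,u)\wedge R(u,z,w))\iff\exists v\,(R(y,z,v)\wedge R(x,v,w))$; (2) $R$ is antitone in its first two arguments and isotone in the third; (3) if $R(x,y,z)$ fails, then there are clopen up-sets $U\ni x$, $V\ni y$ with $z\notin R[U,V,-]$; (4) $R[U,V,-]$, $\{z: R[z,V,-]\subseteq U\}$, $\{z: R[V,z,-]\subseteq U\}$ are clopen; (5) $R[U,E,-]=R[E,U,-]=U$. It is an object of $\mathsf{MTL}^\tau$ if moreover $R(x,y,z)\iff R(y,x,z)$; $E=X$; and $R(x,y,z)$, $R(x,v,w)$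 imply $y\le w$ or $v\le z$. A $\mathsf{GMTL}^\tau$-space is an object of $\mathsf{MTL}^\tau$ with a greatest element $\top$ such that $R(\top,\top,\top)$. In such a space, $x\bullet y$ is the least $z$ with $R(x,y,z)$, and $x\Rightarrow y$ is the greatest $z$ with $R(z,x,y)$, if there is one; the nonempty clopen up-sets form a GMTL-algebra $\mathcal A(X)$ under $\cap$, $\cup$, $U\cdot V=R[U,V,-]$, $U\to V=\{x:R[x,U,-]\subseteq V\}$ and $1=X$. A $\mathsf{GMTL}^\tau$-morphism is a continuous isotone map $\alpha:X\to Y$ with $\alpha(\top)=\top$ such that: $R(x,y,z)$ implies $R(\alpha x,\alpha y,\alpha z)$; if $R(u,v,\alpha z)$, then $u\le\alpha x$, $v\le\alpha y$, $R(x,y,z)$ for some $x,y$; for all clopen up-sets $U,V\subseteq Y$ and $x\in X$, $R[x,\alpha^{-1}U,-]\subseteq\alpha^{-1}V$ implies $R[\alpha x,U,-]\subseteq V$; and $\alpha^{-1}[E_Y]\subseteq E_X$. **Dual quadruples.** A dual quadruple $(S,X,\Upsilon,\Delta)$ consists of a Stone space $S$, whose Boolean algebra of clopen sets is denoted $\mathcal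 A(S)$; a $\mathsf{GMTL}^\tau$-space $X$; a family $\Upsilon=\{\upsilon_U\}_{U\in\mathcal A(S)}$ of $\mathsf{GMTL}^\tau$-morphisms $X\to X$ for which $(U,V)\mapsto\upsilon_U^{-1}[V]$ is an external join $\mathcal A(S)\times\mathcal A(X)\to\mathcal A(X)$; and a continuous closure operator $\Delta$ on $X$ such that $R(x,y,z)$ implies $R(\Delta x,\Delta y,\Delta z)$. **The space $S\otimes^\Delta_\Upsilon X$.** Say that $u\in S$ fixes $x\in X$ if $\upsilon_U(x)=x$ for every clopen $U\subseteq S$ with $u\notin U$. Let $D=\{(u,x)\in S\times X:u\text{ fixes }x\}$ and $D^\partial=\{+(u,\Delta x):(u,x)\in D,\ \Delta x\ne\top\}$, where $+$ marks a disjoint copy. The carrier is $T=D\sqcup D^\partial$. The order is: $(u,x)\sqsubseteq(v,y)$ iff $u=v$ and $x\le y$; $+(u,x)\sqsubseteq+(v,y)$ iff $u=v$ and $y\le x$; $(u,x)\sqsubseteq+(v,y)$ iff $u=v$; and never $+(u,x)\sqsubseteq(v,y)$. The topology has as subbase the sets $$W_{(U,V)}=\bigl[(U\times V)\cup{+}\bigl(U\times\Delta[X]\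 \cup\ S\times\Delta[V]^{\mathsf c}\bigr)\bigr]\cap T\qquad(U\in\mathcal A(S),\ V\in\mathcal A(X))$$ and their complements. A partial operation $\circ$ on $T$ is given by $(u,x)\circ(u,y)=(u,x\bullet y)$; $(u,x)\circ{+}(u,y)={+}(u,y)\circ(u,x)={+}(u,x\Rightarrow\Delta y)$ if $x\le\Delta y$; and $\circ$ is undefined otherwise. Finally $R(p,q,r)$ holds iff $p\circ q$ exists and $p\circ q\sqsubseteq r$, and the distinguished set is $E=T$. **Theorem.** Let $(S,X,\Upsilon,\Delta)$ be a dual quadruple. Then $S\otimes^\Delta_\Upsilon X$ is the extended Priestley dual of some SBP-algebra $L$, that is, there is a homeomorphism from $T$ onto the extended Priestley dual of $L$ that preserves and reflects the order, the relation $R$ and the distinguished set. Moreover $L$ can be taken to be the algebra $B\otimes_e^\delta A$, where $B=\mathcal A(S)$, $A=\mathcal A(X)$, $U\vee_eV=\nu_U(V)=\upsilon_U^{-1}[V]$ and $\delta(V)=\Delta^{-1}[V]$. Here $B\otimes_e^\delta A$ is the quotient of $B\times A$ by the relation $(u,x)\sim(v,y)$ iff $u=v$, $\nu_{\neg u}(x)=\nu_{\neg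 u}(y)$ and $\nu_u(\delta x)=\nu_u(\delta y)$, with least element $[0,1]$, unit $[1,1]$ and the operations $$[u,x]\odot[v,y]=[u\wedge v,\ \nu_{u\vee\neg v}(y\to\delta x)\wedge\nu_{\neg u\vee v}(x\to\delta y)\wedge\nu_{\neg u\vee\neg v}(x\cdot y)],$$ $$[u,x]\Rightarrow[v,y]=[u\to v,\ \nu_{u\vee v}(\delta y\to\delta x)\wedge\nu_{\neg u\vee v}(\delta(x\cdot y))\wedge\nu_{\neg u\vee\neg v}(x\to y)],$$ $$[u,x]\sqcap[v,y]=[u\wedge v,\ \nu_{u\vee v}(x\vee y)\wedge\nu_{u\vee\neg v}(x)\wedge\nu_{\neg u\vee v}(y)\wedge\nu_{\neg u\vee\neg v}(x\wedge y)],$$ $$[u,x]\sqcup[v,y]=[u\vee v,\ \nu_{u\vee v}(x\wedge y)\wedge\nu_{u\vee\neg v}(y)\wedge\nu_{\neg u\vee v}(x)\wedge\nu_{\neg u\vee\neg v}(x\vee y)].$$ -/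

import Mathlib

universe u v

namespace MTLDuality

open TopologicalSpace

/-! ## Algebras -/

/-- A GMTL-algebra: a commutative integral distributive residuated lattice satisfying
prelinearity. The monoid unit `1` is the greatest element and `a ⇨ b` is the residual. -/
class GMTLAlgebra (A : Type*) extends DistribLattice A, CommMonoid A, HImp A where
  le_one' : ∀ a : A, a ≤ 1
  residuation : ∀ a b c : A, a * b ≤ c ↔ b ≤ a ⇨ c
  prelinear : ∀ a b : A, (a ⇨ b) ⊔ (b ⇨ a) = 1

/-- An MTL-algebra: a GMTL-algebra with a (designated) least element `⊥`. -/
class MTLAlgebra (A : Type*) extends GMTLAlgebra A, OrderBot A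

section MTL
variable {A : Type*} [MTLAlgebra A]

/-- The negation `¬ a = a → 0`. -/
def neg (a : A) : A := a ⇨ ⊥

/-- `a ⊕ b = ¬ (¬ a · ¬ b)`. -/
def oplus (a b : A) : A := neg (neg a * neg b)

end MTL

/-- An SBP-algebra: an MTL-algebra satisfying
`¬ (a²) → (¬¬a → a) = 1` and `(2a)² = 2 (a²)`. -/
class SBPAlgebra (A : Type*) extends MTLAlgebra A where
  neg_sq : ∀ a : A, neg (a * a) ⇨ (neg (neg a) ⇨ a) = 1
  double_sq : ∀ a : A, oplus a a * oplus a a = oplus (a * a) (a * a)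

/-- `f` is an endomorphism of the GMTL-algebra `A`. -/
structure IsGMTLEndomorphism {A : Type*} [GMTLAlgebra A] (f : A → A) : Prop where
  map_inf : ∀ a b, f (a ⊓ b) = f a ⊓ f b
  map_sup : ∀ a b, f (a ⊔ b) = f a ⊔ f b
  map_mul : ∀ a b, f (a * b) = f a * f b
  map_himp : ∀ a b, f (a ⇨ b) = f a ⇨ f b
  map_one : f 1 = 1

/-- `ν : B → A → A` is an external join between the Boolean algebra `B` and the GMTL-algebra `A`;
`ν u x` stands for `u ∨ₑ x`. -/
structure IsExternalJoin {B A : Type*} [BooleanAlgebra B] [GMTLAlgebra A]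
    (ν : B → A → A) : Prop where
  endo : ∀ u, IsGMTLEndomorphism (ν u)
  map_inf_left : ∀ u v x, ν (u ⊓ v) x = ν u x ⊓ ν v x
  map_sup_left : ∀ u v x, ν (u ⊔ v) x = ν u x ⊔ ν v x
  bot_left : ∀ x, ν ⊥ x = x
  top_left : ∀ x, ν ⊤ x = 1
  sup_eq : ∀ u v x y, ν u x ⊔ ν v y = ν (u ⊔ v) (x ⊔ y)
  sup_eq_comp : ∀ u v x y, ν (u ⊔ v) (x ⊔ y) = ν u (ν v (x ⊔ y))

/-- `q : B × A → L` exhibits the SBP-algebra `L` as the algebra `B ⊗ₑ^δ A`: `q` is the quotient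
map of `B × A` by the equivalence relation `∼`, so that `q (u, x)` plays the role of the class
`[u, x]`, and the operations of `L` are given on classes by the defining formulas. -/
structure IsTensor {B A L : Type*} [BooleanAlgebra B] [GMTLAlgebra A] [SBPAlgebra L]
    (ν : B → A → A) (δ : A → A) (q : B × A → L) : Prop where
  surjective : Function.Surjective q
  eq_iff : ∀ u x v y, q (u, x) = q (v, y) ↔
    u = v ∧ ν uᶜ x = ν uᶜ y ∧ ν u (δ x) = ν u (δ y)
  map_mul : ∀ u x v y, q (u, x) * q (v, y) =
    q (u ⊓ v, ν (u ⊔ vᶜ) (y ⇨ δ x) ⊓ ν (uᶜ ⊔ v) (x ⇨ δ y) ⊓ ν (uᶜ ⊔ vᶜ) (x * y))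
  map_himp : ∀ u x v y, q (u, x) ⇨ q (v, y) =
    q (u ⇨ v, ν (u ⊔ v) (δ y ⇨ δ x) ⊓ ν (uᶜ ⊔ v) (δ (x * y)) ⊓ ν (uᶜ ⊔ vᶜ) (x ⇨ y))
  map_inf : ∀ u x v y, q (u, x) ⊓ q (v, y) =
    q (u ⊓ v, ν (u ⊔ v) (x ⊔ y) ⊓ ν (u ⊔ vᶜ) x ⊓ ν (uᶜ ⊔ v) y ⊓ ν (uᶜ ⊔ vᶜ) (x ⊓ y))
  map_sup : ∀ u x v y, q (u, x) ⊔ q (v, y) =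
    q (u ⊔ v, ν (u ⊔ v) (x ⊓ y) ⊓ ν (u ⊔ vᶜ) y ⊓ ν (uᶜ ⊔ v) x ⊓ ν (uᶜ ⊔ vᶜ) (x ⊔ y))
  map_bot : q (⊥, 1) = ⊥
  map_one : q (⊤, 1) = 1

/-! ## The extended Priestley dual of an MTL-algebra -/

/-- The carrier of the dual of an MTL-algebra: its (proper) prime filters. -/
def DualSpace (A : Type*) [MTLAlgebra A] : Type _ :=
  {F : Order.PFilter A // F.IsPrime}

namespace DualSpace
variable {A : Type*} [MTLAlgebra A]

/-- Prime filters are ordered by inclusion. -/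
instance : PartialOrder (DualSpace A) :=
  inferInstanceAs (PartialOrder {F : Order.PFilter A // F.IsPrime})

/-- `φ a` is the set of prime filters containing `a`. -/
def φ (a : A) : Set (DualSpace A) := {F | a ∈ F.1}

/-- The topology generated by the sets `φ a` and their complements. -/
instance : TopologicalSpace (DualSpace A) :=
  TopologicalSpace.generateFrom {s | ∃ a : A, s = φ a ∨ s = (φ a)ᶜ}

/-- `F • G`, the up-set generated by the complex product of two filters. -/
def bullet (F G : DualSpace A) : Set A := {c | ∃ a ∈ F.1, ∃ b ∈ G.1, a * b ≤ c}

/-- The ternary relation of the dual space: `F • G ⊆ H`. -/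
def Rel (F G H : DualSpace A) : Prop := bullet F G ⊆ (H.1 : Set A)

/-- The distinguished subset of the dual space: the prime filters containing the unit. -/
def unit (A : Type*) [MTLAlgebra A] : Set (DualSpace A) := φ 1

end DualSpace

/-! ## Unpointed residuated spaces -/

/-- `R[U, V, -]`. -/
def relImage {X : Type*} (R : X → X → X → Prop) (U V : Set X) : Set X :=
  {z | ∃ x ∈ U, ∃ y ∈ V, R x y z}

/-- Unpointed residuated spaces. -/
class ResiduatedSpace (X : Type*) [TopologicalSpace X] [PartialOrder X]
    extends CompactSpace X, PriestleySpace X where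
  R : X → X → X → Prop
  E : ClopenUpperSet X
  assoc : ∀ x y z w, (∃ u, R x y u ∧ R u z w) ↔ ∃ v, R y z v ∧ R x v w
  mono : ∀ {x y z x' y' z'}, x' ≤ x → y' ≤ y → z ≤ z' → R x y z → R x' y' z'
  sep : ∀ x y z, ¬ R x y z → ∃ U V : ClopenUpperSet X, x ∈ U ∧ y ∈ V ∧ z ∉ relImage R U V
  clopen_mul : ∀ U V : ClopenUpperSet X, IsClopen (relImage R U V)
  clopen_left : ∀ U V : ClopenUpperSet X, IsClopen {z | relImage R {z} V ⊆ (U : Set X)}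
  clopen_right : ∀ U V : ClopenUpperSet X, IsClopen {z | relImage R V {z} ⊆ (U : Set X)}
  mul_unit : ∀ U : ClopenUpperSet X, relImage R U E = (U : Set X)
  unit_mul : ∀ U : ClopenUpperSet X, relImage R E U = (U : Set X)

/-- Objects of `MTL^τ`: the unpointed residuated spaces which are commutative, integral and
prelinear. -/
class MTLSpace (X : Type*) [TopologicalSpace X] [PartialOrder X] extends ResiduatedSpace X where
  R_comm : ∀ x y z, R x y z ↔ R y x z
  E_eq_top : E = ⊤
  R_prelinear : ∀ x y z v w, R x y z → R x v w → y ≤ w ∨ v ≤ z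

/-- Objects of `GMTL^τ`: objects of `MTL^τ` with a greatest element `⊤` whose square is defined,
i.e. `R ⊤ ⊤ ⊤` holds. The last condition says precisely that the nonempty clopen up-sets are closed
under multiplication. -/
class GMTLSpace (X : Type*) [TopologicalSpace X] [PartialOrder X] [OrderTop X]
    extends MTLSpace X where
  R_top : R ⊤ ⊤ ⊤

/-- Morphisms of `GMTL^τ`: bounded morphisms of unpointed residuated spaces preserving `⊤`. -/
structure GMTLSpaceHom (X Y : Type*)
    [TopologicalSpace X] [PartialOrder X] [OrderTop X] [GMTLSpace X]
    [TopologicalSpace Y] [PartialOrder Y] [OrderTop Y] [GMTLSpace Y] where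
  toFun : X → Y
  continuous : Continuous toFun
  monotone : Monotone toFun
  map_R : ∀ x y z, ResiduatedSpace.R x y z → ResiduatedSpace.R (toFun x) (toFun y) (toFun z)
  lift_R : ∀ u v z, ResiduatedSpace.R u v (toFun z) →
    ∃ x y, u ≤ toFun x ∧ v ≤ toFun y ∧ ResiduatedSpace.R x y z
  residual : ∀ (U V : ClopenUpperSet Y) (x : X),
    relImage ResiduatedSpace.R {x} (toFun ⁻¹' U) ⊆ toFun ⁻¹' V →
      relImage ResiduatedSpace.R {toFun x} U ⊆ (V : Set Y)
  preimage_E : toFun ⁻¹' (ResiduatedSpace.E : ClopenUpperSet Y) ⊆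
    ((ResiduatedSpace.E : ClopenUpperSet X) : Set X)
  map_top : toFun ⊤ = ⊤

/-! ## The GMTL-algebra of nonempty clopen up-sets -/

/-- The carrier of `𝒜(X)` for a space with a greatest element: nonempty clopen up-sets. -/
@[ext]
structure Ups (X : Type*) [TopologicalSpace X] [PartialOrder X] where
  carrier : Set X
  isClopen : IsClopen carrier
  isUpper : IsUpperSet carrier
  nonempty : carrier.Nonempty

namespace Ups

variable {X : Type*} [TopologicalSpace X] [PartialOrder X]

/-- Forget nonemptiness. -/
def toClopenUpperSet (U : Ups X) : ClopenUpperSet X := ⟨⟨U.carrier, U.isClopen⟩, U.isUpper⟩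

section Top
variable [OrderTop X]

theorem top_mem (U : Ups X) : (⊤ : X) ∈ U.carrier :=
  let ⟨_, hx⟩ := U.nonempty
  U.isUpper le_top hx

/-- The lattice operations are union and intersection; the order is inclusion. -/
instance : DistribLattice (Ups X) where
  le U V := U.carrier ⊆ V.carrier
  le_refl U := Set.Subset.refl U.carrier
  le_trans _ _ _ h k := Set.Subset.trans h k
  le_antisymm _ _ h k := Ups.ext (Set.Subset.antisymm h k)
  sup U V := ⟨U.carrier ∪ V.carrier, U.isClopen.union V.isClopen, U.isUpper.union V.isUpper,
    ⟨⊤, Or.inl U.top_mem⟩⟩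
  inf U V := ⟨U.carrier ∩ V.carrier, U.isClopen.inter V.isClopen, U.isUpper.inter V.isUpper,
    ⟨⊤, U.top_mem, V.top_mem⟩⟩
  le_sup_left _ _ := Set.subset_union_left
  le_sup_right _ _ := Set.subset_union_right
  sup_le _ _ _ h k := Set.union_subset h k
  inf_le_left _ _ := Set.inter_subset_left
  inf_le_right _ _ := Set.inter_subset_right
  le_inf _ _ _ h k := Set.subset_inter h k
  le_sup_inf U V W := by
    rintro x ⟨h | h, h' | h'⟩
    · exact Or.inl h
    · exact Or.inl h
    · exact Or.inl h'
    · exact Or.inr ⟨h, h'⟩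

end Top

section GMTL
variable [OrderTop X] [GMTLSpace X]

theorem le_of_R {x y z : X} (h : ResiduatedSpace.R x y z) : x ≤ z := by
  by_contra hn
  obtain ⟨U, hU, hU', hx, hz⟩ := exists_isClopen_upper_of_not_le hn
  have key := ResiduatedSpace.mul_unit (⟨⟨U, hU⟩, hU'⟩ : ClopenUpperSet X)
  rw [MTLSpace.E_eq_top] at key
  have hz' : z ∈ relImage ResiduatedSpace.R U ((⊤ : ClopenUpperSet X) : Set X) :=
    ⟨x, hx, y, trivial, h⟩
  exact hz (key.subset hz')

/-- The product `U · V = R[U, V, -]`. -/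
instance : Mul (Ups X) where
  mul U V := ⟨relImage ResiduatedSpace.R U.carrier V.carrier,
    ResiduatedSpace.clopen_mul U.toClopenUpperSet V.toClopenUpperSet,
    fun _ _ h ⟨x, hx, y, hy, hR⟩ => ⟨x, hx, y, hy, ResiduatedSpace.mono le_rfl le_rfl h hR⟩,
    ⟨⊤, ⊤, U.top_mem, ⊤, V.top_mem, GMTLSpace.R_top⟩⟩

/-- The unit is the whole space. -/
instance : One (Ups X) where
  one := ⟨Set.univ, isClopen_univ, isUpperSet_univ, ⟨⊤, trivial⟩⟩

/-- The residual `U → V = {x | R[x, U, -] ⊆ V}`. -/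
instance : HImp (Ups X) where
  himp U V := ⟨{x | relImage ResiduatedSpace.R {x} U.carrier ⊆ V.carrier},
    ResiduatedSpace.clopen_left V.toClopenUpperSet U.toClopenUpperSet,
    fun _ _ h hx _ ⟨_, ha, y, hy, hR⟩ =>
      hx ⟨_, rfl, y, hy, ResiduatedSpace.mono (h.trans_eq ha.symm) le_rfl le_rfl hR⟩,
    ⟨⊤, fun _ ⟨_, ha, _, _, hR⟩ =>
      V.isUpper (ha.symm.trans_le (le_of_R hR)) V.top_mem⟩⟩

theorem mul_comm' (U V : Ups X) : U * V = V * U := by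
  apply Ups.ext
  ext z
  constructor
  · rintro ⟨x, hx, y, hy, h⟩
    exact ⟨y, hy, x, hx, (MTLSpace.R_comm _ _ _).1 h⟩
  · rintro ⟨x, hx, y, hy, h⟩
    exact ⟨y, hy, x, hx, (MTLSpace.R_comm _ _ _).1 h⟩

theorem one_mul' (U : Ups X) : 1 * U = U := by
  apply Ups.ext
  have key := ResiduatedSpace.unit_mul U.toClopenUpperSet
  rw [MTLSpace.E_eq_top] at key
  exact key

theorem mul_assoc' (U V W : Ups X) : U * V * W = U * (V * W) := by
  apply Ups.ext
  ext w
  constructor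
  · rintro ⟨u, ⟨x, hx, y, hy, h⟩, z, hz, h'⟩
    obtain ⟨v, hv, hv'⟩ := (ResiduatedSpace.assoc x y z w).1 ⟨u, h, h'⟩
    exact ⟨x, hx, v, ⟨y, hy, z, hz, hv⟩, hv'⟩
  · rintro ⟨x, hx, v, ⟨y, hy, z, hz, hv⟩, hv'⟩
    obtain ⟨u, h, h'⟩ := (ResiduatedSpace.assoc x y z w).2 ⟨v, hv, hv'⟩
    exact ⟨u, ⟨x, hx, y, hy, h⟩, z, hz, h'⟩

/-- The GMTL-algebra `𝒜(X)` of nonempty clopen up-sets of an object of `GMTL^τ`. -/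
instance : GMTLAlgebra (Ups X) where
  mul_assoc := mul_assoc'
  one_mul := one_mul'
  mul_one U := (mul_comm' U 1).trans (one_mul' U)
  mul_comm := mul_comm'
  le_one' U := Set.subset_univ U.carrier
  residuation U V W := by
    constructor
    · rintro h y hy z ⟨_, rfl, x, hx, hR⟩
      exact h ⟨x, hx, _, hy, (MTLSpace.R_comm _ _ _).1 hR⟩
    · rintro h z ⟨x, hx, y, hy, hR⟩
      exact h hy ⟨y, rfl, x, hx, (MTLSpace.R_comm _ _ _).1 hR⟩
  prelinear U V := by
    apply Ups.ext
    refine Set.eq_univ_of_forall fun x => ?_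
    by_contra hn
    have h1 : ¬ relImage ResiduatedSpace.R {x} U.carrier ⊆ V.carrier := fun h => hn (Or.inl h)
    have h2 : ¬ relImage ResiduatedSpace.R {x} V.carrier ⊆ U.carrier := fun h => hn (Or.inr h)
    obtain ⟨z, ⟨_, rfl, y, hy, hR⟩, hz⟩ := Set.not_subset.1 h1
    obtain ⟨w, ⟨_, rfl, v, hv, hR'⟩, hw⟩ := Set.not_subset.1 h2
    rcases MTLSpace.R_prelinear _ _ _ _ _ hR hR' with h | h
    · exact hw (U.isUpper h hy)
    · exact hz (V.isUpper h hv)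

/-- The inverse image of a nonempty clopen up-set under a continuous isotone map preserving `⊤`. -/
def comap (f : X → X) (hc : Continuous f) (hm : Monotone f) (ht : f ⊤ = ⊤) (U : Ups X) : Ups X :=
  ⟨f ⁻¹' U.carrier, U.isClopen.preimage hc, U.isUpper.preimage hm,
    ⟨⊤, by rw [Set.mem_preimage, ht]; exact U.top_mem⟩⟩

end GMTL
end Ups

/-! ## Dual quadruples and the dual construction -/

/-- A dual quadruple `(S, X, Υ, Δ)`, where the Stone space `S` and the object `X` of `GMTL^τ` are
given; `𝒜(S)` is the Boolean algebra `Clopens S` of clopen sets. -/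
structure DualQuadruple (S : Type u) (X : Type v)
    [TopologicalSpace S] [CompactSpace S] [T2Space S] [TotallyDisconnectedSpace S]
    [TopologicalSpace X] [PartialOrder X] [OrderTop X] [GMTLSpace X] where
  υ : Clopens S → GMTLSpaceHom X X
  externalJoin : IsExternalJoin fun (U : Clopens S) (V : Ups X) =>
    V.comap (υ U).toFun (υ U).continuous (υ U).monotone (υ U).map_top
  Δ : ClosureOperator X
  Δ_continuous : Continuous Δ
  Δ_R : ∀ x y z : X, ResiduatedSpace.R x y z → ResiduatedSpace.R (Δ x) (Δ y) (Δ z)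

namespace DualQuadruple

variable {S : Type u} {X : Type v}
  [TopologicalSpace S] [CompactSpace S] [T2Space S] [TotallyDisconnectedSpace S]
  [TopologicalSpace X] [PartialOrder X] [OrderTop X] [GMTLSpace X]
  (Q : DualQuadruple S X)

/-- The external join `(U, V) ↦ υ_U⁻¹[V]`. -/
def ν (U : Clopens S) (V : Ups X) : Ups X :=
  V.comap (Q.υ U).toFun (Q.υ U).continuous (Q.υ U).monotone (Q.υ U).map_top

/-- The operator `V ↦ Δ⁻¹[V]`. -/
def δ (V : Ups X) : Ups X :=
  V.comap Q.Δ Q.Δ_continuous Q.Δ.monotone (top_le_iff.1 (Q.Δ.le_closure ⊤))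

/-- `u` fixes `x`. -/
def Fixes (u : S) (x : X) : Prop := ∀ U : Clopens S, u ∉ U → (Q.υ U).toFun x = x

/-- The set `D` of pairs `(u, x)` such that `u` fixes `x`. -/
def Low : Set (S × X) := {p | Q.Fixes p.1 p.2}

/-- The set underlying `D^∂`: pairs `(u, Δ x)` such that `u` fixes `x` and `Δ x ≠ ⊤`. -/
def Up : Set (S × X) := {p | ∃ x, Q.Fixes p.1 x ∧ Q.Δ x ≠ ⊤ ∧ p.2 = Q.Δ x}

/-- The carrier `T` of `S ⊗ X`: the disjoint union of `D` and `D^∂`. The element `(u, x)` of `D`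
is `Sum.inl ⟨(u, x), _⟩`, the element `+(u, y)` of `D^∂` is `Sum.inr ⟨(u, y), _⟩`. -/
def Space : Type (max u v) := Q.Low ⊕ Q.Up

namespace Space

variable {Q}

/-- The order `⊑` of `S ⊗ X`. -/
def le : Q.Space → Q.Space → Prop
  | Sum.inl p, Sum.inl q => p.1.1 = q.1.1 ∧ p.1.2 ≤ q.1.2
  | Sum.inr p, Sum.inr q => p.1.1 = q.1.1 ∧ q.1.2 ≤ p.1.2
  | Sum.inl p, Sum.inr q => p.1.1 = q.1.1
  | Sum.inr _, Sum.inl _ => False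

instance : PartialOrder Q.Space where
  le := le
  le_refl := by rintro (p | p) <;> exact ⟨rfl, le_rfl⟩
  le_trans := by
    rintro (p | p) (q | q) (r | r) h k
    · exact ⟨h.1.trans k.1, h.2.trans k.2⟩
    · exact Eq.trans h.1 k
    · exact k.elim
    · exact Eq.trans h k.1
    · exact h.elim
    · exact h.elim
    · exact k.elim
    · exact ⟨h.1.trans k.1, k.2.trans h.2⟩
  le_antisymm := by
    rintro (p | p) (q | q) h k
    · exact congrArg Sum.inl (Subtype.ext (Prod.ext h.1 (le_antisymm h.2 k.2)))
    · exact k.elim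
    · exact h.elim
    · exact congrArg Sum.inr (Subtype.ext (Prod.ext h.1 (le_antisymm k.2 h.2)))

/-- The set `W_(U,V)`. -/
def W (U : Clopens S) (V : Ups X) : Set Q.Space := fun t =>
  match t with
  | Sum.inl p => p.1.1 ∈ U ∧ p.1.2 ∈ V.carrier
  | Sum.inr p => p.1.1 ∈ U ∨ p.1.2 ∉ Q.Δ '' V.carrier

/-- The topology with subbase the sets `W_(U,V)` and their complements. -/
instance : TopologicalSpace Q.Space :=
  TopologicalSpace.generateFrom {s | ∃ U V, s = W U V ∨ s = (W U V)ᶜ}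

/-- The graph of the partial operation `∘`: `Circ p q r` means that `p ∘ q` is defined and equal
to `r`. Here `x • y` is the least `z` with `R x y z`, and `x ⇒ y` is the greatest `z` with
`R z x y`. -/
def Circ : Q.Space → Q.Space → Q.Space → Prop
  | Sum.inl p, Sum.inl q, Sum.inl r =>
      p.1.1 = q.1.1 ∧ r.1.1 = p.1.1 ∧ IsLeast {z | ResiduatedSpace.R p.1.2 q.1.2 z} r.1.2
  | Sum.inl p, Sum.inr q, Sum.inr r =>
      p.1.1 = q.1.1 ∧ r.1.1 = p.1.1 ∧ p.1.2 ≤ Q.Δ q.1.2 ∧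
        IsGreatest {z | ResiduatedSpace.R z p.1.2 (Q.Δ q.1.2)} r.1.2
  | Sum.inr q, Sum.inl p, Sum.inr r =>
      p.1.1 = q.1.1 ∧ r.1.1 = p.1.1 ∧ p.1.2 ≤ Q.Δ q.1.2 ∧
        IsGreatest {z | ResiduatedSpace.R z p.1.2 (Q.Δ q.1.2)} r.1.2
  | _, _, _ => False

/-- The ternary relation of `S ⊗ X`: `p ∘ q` exists and `p ∘ q ⊑ r`. -/
def Rel (p q r : Q.Space) : Prop := ∃ s, Circ p q s ∧ s ≤ r

end Space
end DualQuadruple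

/-! ## Isomorphism of the dual construction with an extended Priestley dual -/

/-- An isomorphism in `MTL^τ` from `S ⊗ X` onto the extended Priestley dual of the MTL-algebra
`L`: a homeomorphism preserving and reflecting the order, the ternary relation and the
distinguished subset (which is the whole space in `S ⊗ X`). -/
structure DualIso {S : Type u} {X : Type v}
    [TopologicalSpace S] [CompactSpace S] [T2Space S] [TotallyDisconnectedSpace S]
    [TopologicalSpace X] [PartialOrder X] [OrderTop X] [GMTLSpace X]
    (Q : DualQuadruple S X) (L : Type*) [MTLAlgebra L] where
  toHomeomorph : Q.Space ≃ₜ DualSpace L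
  map_le : ∀ p q, p ≤ q ↔ toHomeomorph p ≤ toHomeomorph q
  map_Rel : ∀ p q r, DualQuadruple.Space.Rel p q r ↔
    DualSpace.Rel (toHomeomorph p) (toHomeomorph q) (toHomeomorph r)
  map_unit : ∀ p, p ∈ (Set.univ : Set Q.Space) ↔ toHomeomorph p ∈ DualSpace.unit L

end MTLDuality

open MTLDuality

/-! Over a single point `u` of `S` the external join degenerates: `ν_Z` becomes the constant `1`
when `u ∈ Z` and the identity when `u ∉ Z`. The class `[U, x]` then turns into an upper copy of `x`
if `u ∈ U` and into a lower copy of `δ x` if `u ∉ U`, and the long formulas for the operations of `B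
⊗ₑ^δ A` collapse to the case-by-case operations of the `δ`-rotation of `A`. This principle is used
twice.

On the algebraic side it shows that `B ⊗ₑ^δ A` is an SBP-algebra without checking its axioms on the
formulas. The rotation is an SBP-algebra, so are its reduced powers and their subalgebras, and
`localRep` sends `(U, x)` to the germ of its local representatives. `localRep_mul` and its
companions show that the range is closed under the operations, and `localRep_eq_iff`, through
compactness of `S`, shows that the kernel is exactly `∼` (`exists_isTensor`).

On the dual side, if `u` fixes `x` then `x ∈ ν_Z V` iff `u ∈ Z` or `x ∈ V` (`Fixes.mem_ν`). Hence
`[U, V] ↦ W_(U,V)` is a well-defined lattice embedding into the subsets of `T` (`W_eq_iff`,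
`W_inter`, `W_union`). A point `t` gives the prime filter of all `[U, V]` with `t ∈ W_(U,V)`. Every
prime filter arises in this way by compactness of `S` and `X` (`Space.exists_point`), the sets `W`
detect the order (`le_iff_forall_mem_W`) and generate the topology, and `Rel_iff_MulRel` identifies
`R` with the relation defined by products of filters. -/

namespace MTLDuality

/-! ## Arithmetic of GMTL-algebras -/

namespace GMTLAlgebra
variable {A : Type*} [GMTLAlgebra A] {a b c x y z : A}

theorem le_one (a : A) : a ≤ 1 := le_one' a

theorem eq_one_iff : a = 1 ↔ 1 ≤ a := ⟨fun h => h.ge, fun h => le_antisymm (le_one a) h⟩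

theorem one_inf (a : A) : 1 ⊓ a = a := inf_eq_right.2 (le_one a)

theorem inf_one (a : A) : a ⊓ 1 = a := inf_eq_left.2 (le_one a)

theorem mul_le_iff : a * b ≤ c ↔ b ≤ a ⇨ c := residuation a b c

theorem mul_himp_le (a b : A) : a * (a ⇨ b) ≤ b := mul_le_iff.2 le_rfl

theorem mul_le_mul_l (h : b ≤ c) (a : A) : a * b ≤ a * c :=
  mul_le_iff.2 (h.trans (mul_le_iff.1 le_rfl))

theorem mul_le_mul_r (h : b ≤ c) (a : A) : b * a ≤ c * a := by
  rw [mul_comm b, mul_comm c]; exact mul_le_mul_l h a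

theorem mul_le_right (a b : A) : a * b ≤ b := by
  simpa using mul_le_mul_r (le_one a) b

theorem mul_le_left (a b : A) : a * b ≤ a := by
  rw [mul_comm]; exact mul_le_right b a

theorem one_himp (a : A) : 1 ⇨ a = a :=
  le_antisymm (by simpa using mul_himp_le 1 a) (mul_le_iff.1 (by simp))

theorem himp_eq_one_iff : a ⇨ b = 1 ↔ a ≤ b := by
  rw [eq_one_iff, ← mul_le_iff, mul_one]

theorem himp_self (a : A) : a ⇨ a = 1 := himp_eq_one_iff.2 le_rfl

theorem himp_one (a : A) : a ⇨ 1 = 1 := himp_eq_one_iff.2 (le_one a)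

theorem mul_himp (a b c : A) : (a * b) ⇨ c = a ⇨ (b ⇨ c) :=
  eq_of_forall_le_iff fun x => by
    rw [← mul_le_iff, ← mul_le_iff, ← mul_le_iff, ← mul_assoc, mul_comm b a]

theorem mul_sup (a b c : A) : a * (b ⊔ c) = a * b ⊔ a * c :=
  eq_of_forall_ge_iff fun x => by simp [mul_le_iff]

/-- Prelinearity allows multiplication by `(b ⇨ c) ⊔ (c ⇨ b) = 1`, and on each of the two joinands
`b ⊔ c` is absorbed into one of `b`, `c`. This inequality later makes the filter defining `x • y`
prime. -/
theorem himp_sup_le (a b c : A) : a ⇨ (b ⊔ c) ≤ (a ⇨ b) ⊔ (a ⇨ c) := by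
  have key : ∀ b c : A, (a ⇨ (b ⊔ c)) * (b ⇨ c) ≤ a ⇨ c := fun b c => by
    rw [← mul_le_iff, ← mul_assoc]
    refine (mul_le_mul_r (mul_himp_le a _) _).trans ?_
    rw [mul_comm, mul_sup, mul_comm, mul_comm _ c]
    exact sup_le (mul_himp_le b c) (mul_le_left _ _)
  calc a ⇨ (b ⊔ c) = (a ⇨ (b ⊔ c)) * ((b ⇨ c) ⊔ (c ⇨ b)) := by rw [prelinear, mul_one]
    _ = (a ⇨ (b ⊔ c)) * (b ⇨ c) ⊔ (a ⇨ (b ⊔ c)) * (c ⇨ b) := mul_sup _ _ _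
    _ ≤ (a ⇨ c) ⊔ (a ⇨ b) := sup_le_sup (key b c) (by rw [sup_comm b c]; exact key c b)
    _ = _ := sup_comm _ _

/-- The same splitting along prelinearity. It makes the set defining the greatest `z` with `R z x y`
closed under meets. -/
theorem inf_mul_le (a b c : A) : a * c ⊓ b * c ≤ (a ⊓ b) * c := by
  have key : ∀ a b : A, a * c * (a ⇨ b) ≤ (a ⊓ b) * c := fun a b => by
    rw [mul_right_comm]
    exact mul_le_mul_r (le_inf (mul_le_left _ _) (mul_himp_le a b)) c
  calc a * c ⊓ b * c = (a * c ⊓ b * c) * ((a ⇨ b) ⊔ (b ⇨ a)) := by rw [prelinear, mul_one]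
    _ = (a * c ⊓ b * c) * (a ⇨ b) ⊔ (a * c ⊓ b * c) * (b ⇨ a) := mul_sup _ _ _
    _ ≤ (a ⊓ b) * c := sup_le ((mul_le_mul_r inf_le_left _).trans (key a b))
        ((mul_le_mul_r inf_le_right _).trans (by rw [inf_comm a b]; exact key b a))

end GMTLAlgebra

open GMTLAlgebra

/-! ## The `δ`-rotation of a GMTL-algebra -/

/-- A nucleus of a GMTL-algebra that is a lattice endomorphism. -/
class IsLatticeNucleus {A : Type*} [GMTLAlgebra A] (δ : A → A) : Prop where
  le : ∀ a, a ≤ δ a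
  idem : ∀ a, δ (δ a) = δ a
  map_inf : ∀ a b, δ (a ⊓ b) = δ a ⊓ δ b
  map_sup : ∀ a b, δ (a ⊔ b) = δ a ⊔ δ b
  mul_le : ∀ a b, δ a * δ b ≤ δ (a * b)

namespace IsLatticeNucleus
variable {A : Type*} [GMTLAlgebra A] {δ : A → A} [h : IsLatticeNucleus δ]

theorem mono {a b : A} (hab : a ≤ b) : δ a ≤ δ b := by
  rw [← sup_eq_right, ← h.map_sup, sup_eq_right.2 hab]

theorem map_one : δ 1 = 1 := eq_one_iff.2 (h.le 1)

theorem le_iff {a b : A} (hb : δ b = b) : δ a ≤ b ↔ a ≤ b :=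
  ⟨(h.le a).trans, fun hab => (h.mono hab).trans hb.le⟩

theorem map_himp {a b : A} (hb : δ b = b) : δ (a ⇨ b) = a ⇨ b := by
  refine le_antisymm (mul_le_iff.1 ?_) (h.le _)
  calc a * δ (a ⇨ b) ≤ δ a * δ (a ⇨ b) := mul_le_mul_r (h.le a) _
    _ ≤ δ (a * (a ⇨ b)) := h.mul_le _ _
    _ ≤ δ b := h.mono (mul_himp_le a b)
    _ = b := hb

theorem map_mul_right (a b : A) : δ (a * δ b) = δ (a * b) := by
  refine le_antisymm ?_ (h.mono (mul_le_mul_l (h.le b) a))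
  rw [h.le_iff (h.idem _)]
  exact (mul_le_mul_r (h.le a) _).trans (h.mul_le a b)

end IsLatticeNucleus

/-- The `δ`-rotation of `A`: a copy of `A` on top of an upside-down copy of the set of `δ`-closed
elements. -/
inductive Rotation {A : Type*} (δ : A → A) : Type _
  | high (a : A)
  | low (a : A) (h : δ a = a)

namespace Rotation
variable {A : Type*} {δ : A → A}

theorem low_congr {a b : A} {ha : δ a = a} {hb : δ b = b} (h : a = b) :
    low a ha = low b hb := by
  subst h; rfl

variable [GMTLAlgebra A] [hδ : IsLatticeNucleus δ]

/-- The order of the rotation. -/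
protected def le : Rotation δ → Rotation δ → Prop
  | high a, high b => a ≤ b
  | low a _, low b _ => b ≤ a
  | low _ _, high _ => True
  | high _, low _ _ => False

/-- The meet of the rotation. -/
protected def inf : Rotation δ → Rotation δ → Rotation δ
  | high a, high b => high (a ⊓ b)
  | low a ha, low b hb => low (a ⊔ b) (by rw [hδ.map_sup, ha, hb])
  | low a ha, high _ => low a ha
  | high _, low b hb => low b hb

/-- The join of the rotation. -/
protected def sup : Rotation δ → Rotation δ → Rotation δ
  | high a, high b => high (a ⊔ b)
  | low a ha, low b hb => low (a ⊓ b) (by rw [hδ.map_inf, ha, hb])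
  | low _ _, high b => high b
  | high a, low _ _ => high a

/-- The product of the rotation. -/
protected def mul : Rotation δ → Rotation δ → Rotation δ
  | high a, high b => high (a * b)
  | low _ _, low _ _ => low 1 hδ.map_one
  | low a ha, high b => low (b ⇨ a) (hδ.map_himp ha)
  | high a, low b hb => low (a ⇨ b) (hδ.map_himp hb)

/-- The residual of the rotation. -/
protected def himp : Rotation δ → Rotation δ → Rotation δ
  | high a, high b => high (a ⇨ b)
  | low a _, low b _ => high (b ⇨ a)
  | low _ _, high _ => high 1
  | high a, low b _ => low (δ (a * b)) (hδ.idem _)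

instance : DistribLattice (Rotation δ) where
  le := Rotation.le
  le_refl := by rintro (a | a) <;> exact le_rfl
  le_trans := by
    rintro (a | a) (b | b) (c | c) h k
    · exact le_trans h k
    · exact k.elim
    · exact h.elim
    · exact h.elim
    · trivial
    · exact k.elim
    · trivial
    · exact le_trans k h
  le_antisymm := by
    rintro (a | a) (b | b) h k
    · exact congrArg high (le_antisymm h k)
    · exact h.elim
    · exact k.elim
    · cases le_antisymm h k; rfl
  inf := Rotation.inf
  sup := Rotation.sup
  le_sup_left := by
    rintro (a | a) (b | b)
    · exact le_sup_left
    · exact le_rfl (a := a)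
    · trivial
    · exact inf_le_left
  le_sup_right := by
    rintro (a | a) (b | b)
    · exact le_sup_right
    · trivial
    · exact le_rfl (a := b)
    · exact inf_le_right
  sup_le := by
    rintro (a | a) (b | b) (c | c) h k
    · exact sup_le h k
    · exact h.elim
    · exact h
    · exact h.elim
    · exact k
    · exact k.elim
    · trivial
    · exact le_inf h k
  inf_le_left := by
    rintro (a | a) (b | b)
    · exact inf_le_left
    · trivial
    · exact le_rfl (a := a)
    · exact le_sup_left
  inf_le_right := by
    rintro (a | a) (b | b)
    · exact inf_le_right
    · exact le_rfl (a := b)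
    · trivial
    · exact le_sup_right
  le_inf := by
    rintro (a | a) (b | b) (c | c) h k
    · exact le_inf h k
    · exact k.elim
    · exact h.elim
    · exact h.elim
    · trivial
    · exact k
    · exact h
    · exact sup_le h k
  le_sup_inf := by
    rintro (a | a) (b | b) (c | c)
    · exact le_sup_inf (x := a) (y := b) (z := c)
    · exact inf_le_right (a := a ⊔ b) (b := a)
    · exact inf_le_left (a := a) (b := a ⊔ c)
    · exact inf_le_left (a := a) (b := a)
    · exact le_rfl (a := b ⊓ c)
    · exact le_rfl (a := a ⊓ c)
    · exact le_rfl (a := a ⊓ b)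
    · exact inf_sup_left a b c |>.le

instance : GMTLAlgebra (Rotation δ) where
  mul := Rotation.mul
  one := high 1
  himp := Rotation.himp
  mul_assoc := by
    have h1 : ∀ a b c : A, b ⇨ (a ⇨ c) = a ⇨ (b ⇨ c) := fun a b c => by
      rw [← mul_himp, ← mul_himp, mul_comm]
    rintro (a | ⟨a, ha⟩) (b | ⟨b, hb⟩) (c | ⟨c, hc⟩)
    · exact congrArg high (mul_assoc a b c)
    · exact low_congr (mul_himp a b c)
    · exact low_congr (h1 _ _ _)
    · exact low_congr ((himp_one a).symm)
    · exact low_congr (by rw [h1, mul_himp])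
    · rfl
    · exact low_congr (himp_one c)
    · exact rfl
  one_mul := by
    rintro (a | ⟨a, ha⟩)
    · exact congrArg high (one_mul a)
    · exact low_congr (one_himp a)
  mul_one := by
    rintro (a | ⟨a, ha⟩)
    · exact congrArg high (mul_one a)
    · exact low_congr (one_himp a)
  mul_comm := by
    rintro (a | ⟨a, ha⟩) (b | ⟨b, hb⟩)
    · exact congrArg high (mul_comm a b)
    · rfl
    · rfl
    · rfl
  le_one' := by
    rintro (a | ⟨a, ha⟩)
    · exact le_one a
    · trivial
  residuation := by
    rintro (a | ⟨a, ha⟩) (b | ⟨b, hb⟩) (c | ⟨c, hc⟩)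
    · exact mul_le_iff
    · exact Iff.rfl
    · exact Iff.rfl
    · change c ≤ a ⇨ b ↔ δ (a * c) ≤ b
      rw [hδ.le_iff hb, mul_le_iff]
    · exact iff_of_true trivial (le_one b)
    · change c ≤ b ⇨ a ↔ b ≤ c ⇨ a
      rw [← mul_le_iff, ← mul_le_iff, mul_comm]
    · exact Iff.rfl
    · exact iff_of_true (le_one c) trivial
  prelinear := by
    rintro (a | ⟨a, ha⟩) (b | ⟨b, hb⟩)
    · exact congrArg high (prelinear a b)
    · rfl
    · rfl
    · exact congrArg high (prelinear b a)

/-- Negation exchanges the two halves: it sends `high a` to `low (δ a)` and `low a` to `high a`.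
Double negation therefore fixes low elements, while a high element has a square with low negation,
which lies below every high element; this gives the first identity. In the second, both sides are
`1` for a high element and `⊥` for a low one, because low elements multiply to `⊥`. -/
instance : SBPAlgebra (Rotation δ) where
  bot := low 1 hδ.map_one
  bot_le := by
    rintro (a | ⟨a, ha⟩)
    · trivial
    · exact le_one a
  neg_sq := by
    rintro (a | ⟨a, ha⟩)
    · rfl
    · change high ((1 ⇨ 1) ⇨ (a ⇨ δ ((1 ⇨ a) * 1))) = high 1
      rw [one_himp a, mul_one, ha, himp_self a, himp_one]
  double_sq := by
    rintro (a | ⟨a, ha⟩)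
    · change high ((1 ⇨ 1) * (1 ⇨ 1)) = high (1 ⇨ 1)
      rw [himp_one, mul_one]
    · exact low_congr (by rw [himp_one, mul_one, mul_one, hδ.map_one])

variable {a b : A} {ha : δ a = a} {hb : δ b = b}

@[simp] theorem high_mul_high : (high a * high b : Rotation δ) = high (a * b) := rfl
@[simp] theorem low_mul_low : (low a ha * low b hb : Rotation δ) = low 1 hδ.map_one := rfl
@[simp] theorem low_mul_high :
    (low a ha * high b : Rotation δ) = low (b ⇨ a) (hδ.map_himp ha) := rfl
@[simp] theorem high_mul_low :
    (high a * low b hb : Rotation δ) = low (a ⇨ b) (hδ.map_himp hb) := rfl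

@[simp] theorem high_himp_high : (high a ⇨ high b : Rotation δ) = high (a ⇨ b) := rfl
@[simp] theorem low_himp_low : (low a ha ⇨ low b hb : Rotation δ) = high (b ⇨ a) := rfl
@[simp] theorem low_himp_high : (low a ha ⇨ high b : Rotation δ) = high 1 := rfl
@[simp] theorem high_himp_low :
    (high a ⇨ low b hb : Rotation δ) = low (δ (a * b)) (hδ.idem _) := rfl

@[simp] theorem high_inf_high : (high a ⊓ high b : Rotation δ) = high (a ⊓ b) := rfl
@[simp] theorem low_inf_low :
    (low a ha ⊓ low b hb : Rotation δ) = low (a ⊔ b) (by rw [hδ.map_sup, ha, hb]) := rfl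
@[simp] theorem low_inf_high : (low a ha ⊓ high b : Rotation δ) = low a ha := rfl
@[simp] theorem high_inf_low : (high a ⊓ low b hb : Rotation δ) = low b hb := rfl

@[simp] theorem high_sup_high : (high a ⊔ high b : Rotation δ) = high (a ⊔ b) := rfl
@[simp] theorem low_sup_low :
    (low a ha ⊔ low b hb : Rotation δ) = low (a ⊓ b) (by rw [hδ.map_inf, ha, hb]) := rfl
@[simp] theorem low_sup_high : (low a ha ⊔ high b : Rotation δ) = high b := rfl
@[simp] theorem high_sup_low : (high a ⊔ low b hb : Rotation δ) = high a := rfl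

end Rotation
end MTLDuality

namespace MTLDuality
open GMTLAlgebra TopologicalSpace

/-! ## Reduced powers and subalgebras of SBP-algebras -/

namespace SBPAlgebra
open Filter

variable {ι M : Type*} [SBPAlgebra M]

instance (l : Filter ι) : HImp (Germ l M) := ⟨Germ.map₂ (· ⇨ ·)⟩

/-- Residuation and the equations hold at each index, hence eventually along any filter. -/
instance (l : Filter ι) : GMTLAlgebra (Germ l M) where
  le_one' f := Germ.inductionOn f fun _ => Eventually.of_forall fun _ => le_one _
  residuation f g h := Germ.inductionOn₃ f g h fun _ _ _ =>
    eventually_congr (Eventually.of_forall fun _ => residuation _ _ _)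
  prelinear f g := Germ.inductionOn₂ f g fun _ _ =>
    Germ.coe_eq.2 (Eventually.of_forall fun _ => prelinear _ _)

instance (l : Filter ι) : SBPAlgebra (Germ l M) where
  bot_le f := Germ.inductionOn f fun _ => Eventually.of_forall fun _ => bot_le
  neg_sq f := Germ.inductionOn f fun f =>
    Germ.coe_eq.2 (Eventually.of_forall fun i => neg_sq (f i))
  double_sq f := Germ.inductionOn f fun f =>
    Germ.coe_eq.2 (Eventually.of_forall fun i => double_sq (f i))

/-- A subset of an SBP-algebra closed under the operations is an SBP-algebra. -/
abbrev ofClosed (s : Set M) (mul : ∀ a ∈ s, ∀ b ∈ s, a * b ∈ s)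
    (himp : ∀ a ∈ s, ∀ b ∈ s, a ⇨ b ∈ s) (inf : ∀ a ∈ s, ∀ b ∈ s, a ⊓ b ∈ s)
    (sup : ∀ a ∈ s, ∀ b ∈ s, a ⊔ b ∈ s) (bot : ⊥ ∈ s) (one : 1 ∈ s) : SBPAlgebra s where
  mul a b := ⟨a.1 * b.1, mul _ a.2 _ b.2⟩
  himp a b := ⟨a.1 ⇨ b.1, himp _ a.2 _ b.2⟩
  inf a b := ⟨a.1 ⊓ b.1, inf _ a.2 _ b.2⟩
  sup a b := ⟨a.1 ⊔ b.1, sup _ a.2 _ b.2⟩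
  bot := ⟨⊥, bot⟩
  one := ⟨1, one⟩
  le_sup_left a b := le_sup_left (a := a.1) (b := b.1)
  le_sup_right a b := le_sup_right (a := a.1) (b := b.1)
  sup_le a b c := sup_le (a := a.1) (b := b.1) (c := c.1)
  inf_le_left a b := inf_le_left (a := a.1) (b := b.1)
  inf_le_right a b := inf_le_right (a := a.1) (b := b.1)
  le_inf a b c := le_inf (a := b.1) (b := c.1) (c := a.1)
  le_sup_inf a b c := le_sup_inf (x := a.1) (y := b.1) (z := c.1)
  mul_assoc a b c := Subtype.ext (mul_assoc a.1 b.1 c.1)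
  one_mul a := Subtype.ext (one_mul a.1)
  mul_one a := Subtype.ext (mul_one a.1)
  mul_comm a b := Subtype.ext (mul_comm a.1 b.1)
  le_one' a := le_one a.1
  residuation a b c := residuation a.1 b.1 c.1
  prelinear a b := Subtype.ext (prelinear a.1 b.1)
  bot_le a := bot_le (a := a.1)
  neg_sq a := Subtype.ext (neg_sq a.1)
  double_sq a := Subtype.ext (double_sq a.1)

end SBPAlgebra

/-! ## The algebra `B ⊗ₑ^δ A` -/

namespace IsExternalJoin

section
variable {S : Type u} [TopologicalSpace S] {u : S} {U V : Clopens S}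

theorem mem_inf : u ∈ U ⊓ V ↔ u ∈ U ∧ u ∈ V := Iff.rfl

theorem mem_sup : u ∈ U ⊔ V ↔ u ∈ U ∨ u ∈ V := Iff.rfl

theorem mem_compl : u ∈ Uᶜ ↔ u ∉ U := Iff.rfl

theorem mem_himp : u ∈ U ⇨ V ↔ u ∈ V ∨ u ∉ U := by
  rw [himp_eq]; exact Iff.rfl

end

/-- A family of clopen sets closed under finite intersections that avoids each point of a clopen
set `U` contains a set disjoint from `U`. -/
theorem exists_le_compl {S : Type u} [TopologicalSpace S] [CompactSpace S] {p : Clopens S → Prop}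
    (top : p ⊤) (inf : ∀ V W, p V → p W → p (V ⊓ W)) (U : Clopens S)
    (h : ∀ u ∈ U, ∃ W, u ∉ W ∧ p W) : ∃ W ≤ Uᶜ, p W := by
  obtain ⟨W, hW, h⟩ : ∃ W : Clopens S, (∀ u ∈ (U : Set S), u ∉ W) ∧ p W := by
    refine U.isClopen.isClosed.isCompact.induction_on
      (p := fun s => ∃ W : Clopens S, (∀ u ∈ s, u ∉ W) ∧ p W) ?_ ?_ ?_ ?_
    · exact ⟨⊤, fun _ h => h.elim, top⟩
    · rintro s t hst ⟨W, hW, h⟩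
      exact ⟨W, fun u hu => hW u (hst hu), h⟩
    · rintro s t ⟨W, hW, h⟩ ⟨W', hW', h'⟩
      exact ⟨W ⊓ W', fun u hu hw => hu.elim (fun hu => hW u hu hw.1) fun hu => hW' u hu hw.2,
        inf _ _ h h'⟩
    · intro u hu
      obtain ⟨W, hW, h⟩ := h u hu
      exact ⟨(W : Set S)ᶜ, mem_nhdsWithin_of_mem_nhds (W.isClopen.compl.isOpen.mem_nhds hW), W,
        fun _ h => h, h⟩
  exact ⟨W, fun u hu hu' => hW u hu' hu, h⟩

/-! ### Consequences of the external join axioms -/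

section
variable {B A : Type*} [BooleanAlgebra B] [GMTLAlgebra A] {ν : B → A → A}
  (hν : IsExternalJoin ν)
include hν

theorem comp (u v : B) (x : A) : ν u (ν v x) = ν (u ⊔ v) x := by
  have h := hν.sup_eq_comp u v x x
  rw [sup_idem] at h
  exact h.symm

theorem map_one (u : B) : ν u 1 = 1 := (hν.endo u).map_one

theorem mono (u : B) {x y : A} (h : x ≤ y) : ν u x ≤ ν u y := by
  rw [← sup_eq_right, ← (hν.endo u).map_sup, sup_eq_right.2 h]

theorem inf_compl (u : B) (x : A) : ν u x ⊓ ν uᶜ x = x := by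
  rw [← hν.map_inf_left, inf_compl_eq_bot, hν.bot_left]

/-- No compatibility of `ν` and `δ` is assumed; it is forced. Split `x` as `ν u x ⊓ ν uᶜ x`, a meet
that `δ` preserves. Since `ν uᶜ (ν u x) = 1` and `δ` is inflationary, `ν uᶜ` sends `δ (ν u x)` to
`1`, so this element is fixed by `ν u`; symmetrically `ν u` sends `δ (ν uᶜ x)` to `1`. -/
theorem comm_nucleus {δ : A → A} [hδ : IsLatticeNucleus δ] (u : B) (x : A) :
    ν u (δ x) = δ (ν u x) := by
  have key : ∀ (v : B) (x : A), ν vᶜ (δ (ν v x)) = 1 := fun v x => by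
    have h := hν.mono vᶜ (hδ.le (ν v x))
    rw [hν.comp, compl_sup_eq_top, hν.top_left] at h
    exact eq_one_iff.2 h
  have key' : ν u (δ (ν uᶜ x)) = 1 := by
    have h := key uᶜ x
    rwa [compl_compl] at h
  have h1 : ν u (δ (ν u x)) = δ (ν u x) := by
    have h := hν.inf_compl u (δ (ν u x))
    rwa [key, inf_eq_left.2 (le_one _)] at h
  calc ν u (δ x) = ν u (δ (ν u x ⊓ ν uᶜ x)) := by rw [hν.inf_compl]
    _ = ν u (δ (ν u x)) ⊓ ν u (δ (ν uᶜ x)) := by rw [hδ.map_inf, (hν.endo u).map_inf]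
    _ = δ (ν u x) := by rw [key', h1, inf_eq_left.2 (le_one _)]

end

/-! ### Localization at the points of `S` -/

section
variable {S : Type u} {A : Type v} [TopologicalSpace S] [GMTLAlgebra A]
  {ν : Clopens S → A → A} (hν : IsExternalJoin ν)

/-- The filter of the sets that contain, for every point `u`, all pairs `(u, W)` for which
`u ∉ W` and `W` is large enough. -/
def localFilter (S : Type u) [TopologicalSpace S] : Filter (S × Clopens S) where
  sets := {s | ∀ u, ∃ U : Clopens S, u ∉ U ∧ ∀ W, U ≤ W → u ∉ W → (u, W) ∈ s}
  univ_sets _ := ⟨⊥, fun h => h, fun _ _ _ => trivial⟩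
  sets_of_superset h hst u :=
    let ⟨U, hU, h'⟩ := h u
    ⟨U, hU, fun W hW hu => hst (h' W hW hu)⟩
  inter_sets h k u :=
    let ⟨U, hU, h'⟩ := h u
    let ⟨V, hV, k'⟩ := k u
    ⟨U ⊔ V, fun h => h.elim hU hV, fun W hW hu =>
      ⟨h' W (le_sup_left.trans hW) hu, k' W (le_sup_right.trans hW) hu⟩⟩

include hν

open Classical in
-- Near `u` the index `W` may be taken to contain any prescribed clopen set that misses `u`. If `u ∈
-- Z`, take `W ≥ Zᶜ`, so `W ⊔ Z = ⊤`; if `u ∉ Z`, take `W ≥ Z`, so `W ⊔ Z = W`.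
theorem eventually_comp (Z : Clopens S) (x : A) :
    ∀ᶠ j in localFilter S, ν j.2 (ν Z x) = if j.1 ∈ Z then 1 else ν j.2 x := by
  intro u
  by_cases hu : u ∈ Z
  · refine ⟨Zᶜ, fun h => h hu, fun W hW _ => ?_⟩
    have h : W ⊔ Z = ⊤ := top_le_iff.1 (compl_sup_eq_top (x := Z) ▸ sup_le_sup_right hW Z)
    change _ = ite _ _ _
    rw [if_pos hu, hν.comp, h, hν.top_left]
  · refine ⟨Z, hu, fun W hW _ => ?_⟩
    change _ = ite _ _ _
    rw [if_neg hu, hν.comp, sup_eq_left.2 hW]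

/-- The sets `W` with `ν W x = ν W y` are closed under finite meets, so compactness of `U` glues the
local equalities into one `W ≤ Uᶜ`, and applying `ν Uᶜ` absorbs `ν W`. -/
theorem eq_of_forall_exists [CompactSpace S] {U : Clopens S} {x y : A}
    (h : ∀ u ∈ U, ∃ W : Clopens S, u ∉ W ∧ ν W x = ν W y) : ν Uᶜ x = ν Uᶜ y := by
  obtain ⟨W, hW, hxy⟩ := exists_le_compl (p := fun W => ν W x = ν W y)
    (by rw [hν.top_left, hν.top_left])
    (fun V W h h' => by rw [hν.map_inf_left, hν.map_inf_left, h, h']) U h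
  have hle : Uᶜ ⊔ W = Uᶜ := sup_eq_left.2 hW
  rw [← hle, ← hν.comp, ← hν.comp, hxy]

end

/-! ### Embedding of `B ⊗ₑ^δ A` into a reduced power of the rotation -/

section
open Filter Classical

variable {S : Type u} {A : Type v} [TopologicalSpace S] [GMTLAlgebra A]
  {δ : A → A} [hδ : IsLatticeNucleus δ]

/-- The element of the rotation of `A` represented by a truth value and an element of `A`. -/
noncomputable def toRotation (δ : A → A) [hδ : IsLatticeNucleus δ] (b : Prop) (x : A) :
    Rotation δ :=
  if b then .high x else .low (δ x) (hδ.idem x)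

theorem toRotation_pos {b : Prop} (hb : b) (x : A) : toRotation δ b x = .high x := if_pos hb

theorem toRotation_neg {b : Prop} (hb : ¬ b) (x : A) :
    toRotation δ b x = .low (δ x) (hδ.idem x) := if_neg hb

/-- The family of local representatives of a pair `(U, x)`. -/
noncomputable def localRep (ν : Clopens S → A → A) (δ : A → A) [IsLatticeNucleus δ]
    (p : Clopens S × A) : Germ (localFilter S) (Rotation δ) :=
  ((fun j => toRotation δ (j.1 ∈ p.1) (ν j.2 p.2) : S × Clopens S → Rotation δ) :
    Germ (localFilter S) (Rotation δ))

variable {ν : Clopens S → A → A} (hν : IsExternalJoin ν)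
include hν

/-- By `eventually_comp`, in each of the four cases for membership in `u` and `v` all but at most
one of the factors `ν _ _` becomes `1`, and the remaining one is the rotation's product for that
case. The other three operations are treated alike. -/
theorem localRep_mul (u v : Clopens S) (x y : A) :
    localRep ν δ (u, x) * localRep ν δ (v, y) = localRep ν δ
      (u ⊓ v, ν (u ⊔ vᶜ) (y ⇨ δ x) ⊓ ν (uᶜ ⊔ v) (x ⇨ δ y) ⊓ ν (uᶜ ⊔ vᶜ) (x * y)) := by
  refine Germ.coe_eq.2 ?_
  filter_upwards [hν.eventually_comp (u ⊔ vᶜ) (y ⇨ δ x),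
    hν.eventually_comp (uᶜ ⊔ v) (x ⇨ δ y),
    hν.eventually_comp (uᶜ ⊔ vᶜ) (x * y)] with j h1 h2 h3
  have e := hν.endo j.2
  simp only [e.map_inf, h1, h2, h3, mem_inf, mem_sup, mem_compl]
  by_cases h : j.1 ∈ u <;> by_cases k : j.1 ∈ v <;>
    simp [h, k, toRotation_pos, toRotation_neg, hδ.map_himp (hδ.idem _), hδ.map_one,
      e.map_himp, e.map_mul, hν.comm_nucleus, one_inf, inf_one]

theorem localRep_himp (u v : Clopens S) (x y : A) :
    localRep ν δ (u, x) ⇨ localRep ν δ (v, y) = localRep ν δ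
      (u ⇨ v, ν (u ⊔ v) (δ y ⇨ δ x) ⊓ ν (uᶜ ⊔ v) (δ (x * y)) ⊓ ν (uᶜ ⊔ vᶜ) (x ⇨ y)) := by
  refine Germ.coe_eq.2 ?_
  filter_upwards [hν.eventually_comp (u ⊔ v) (δ y ⇨ δ x),
    hν.eventually_comp (uᶜ ⊔ v) (δ (x * y)),
    hν.eventually_comp (uᶜ ⊔ vᶜ) (x ⇨ y)] with j h1 h2 h3
  have e := hν.endo j.2
  simp only [e.map_inf, h1, h2, h3, mem_sup, mem_compl, mem_himp]
  by_cases h : j.1 ∈ u <;> by_cases k : j.1 ∈ v <;>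
    simp [h, k, toRotation_pos, toRotation_neg, hδ.idem, hδ.map_mul_right, e.map_himp, e.map_mul,
      hν.comm_nucleus, one_inf, inf_one]

theorem localRep_inf (u v : Clopens S) (x y : A) :
    localRep ν δ (u, x) ⊓ localRep ν δ (v, y) = localRep ν δ
      (u ⊓ v, ν (u ⊔ v) (x ⊔ y) ⊓ ν (u ⊔ vᶜ) x ⊓ ν (uᶜ ⊔ v) y ⊓ ν (uᶜ ⊔ vᶜ) (x ⊓ y)) := by
  refine Germ.coe_eq.2 ?_
  filter_upwards [hν.eventually_comp (u ⊔ v) (x ⊔ y),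
    hν.eventually_comp (u ⊔ vᶜ) x,
    hν.eventually_comp (uᶜ ⊔ v) y,
    hν.eventually_comp (uᶜ ⊔ vᶜ) (x ⊓ y)] with j h1 h2 h3 h4
  have e := hν.endo j.2
  simp only [e.map_inf, h1, h2, h3, h4, mem_inf, mem_sup, mem_compl]
  by_cases h : j.1 ∈ u <;> by_cases k : j.1 ∈ v <;>
    simp [h, k, toRotation_pos, toRotation_neg, hδ.map_sup, e.map_sup, one_inf, inf_one]

theorem localRep_sup (u v : Clopens S) (x y : A) :
    localRep ν δ (u, x) ⊔ localRep ν δ (v, y) = localRep ν δ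
      (u ⊔ v, ν (u ⊔ v) (x ⊓ y) ⊓ ν (u ⊔ vᶜ) y ⊓ ν (uᶜ ⊔ v) x ⊓ ν (uᶜ ⊔ vᶜ) (x ⊔ y)) := by
  refine Germ.coe_eq.2 ?_
  filter_upwards [hν.eventually_comp (u ⊔ v) (x ⊓ y),
    hν.eventually_comp (u ⊔ vᶜ) y,
    hν.eventually_comp (uᶜ ⊔ v) x,
    hν.eventually_comp (uᶜ ⊔ vᶜ) (x ⊔ y)] with j h1 h2 h3 h4
  have e := hν.endo j.2
  simp only [e.map_inf, h1, h2, h3, h4, mem_sup, mem_compl]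
  by_cases h : j.1 ∈ u <;> by_cases k : j.1 ∈ v <;>
    simp [h, k, toRotation_pos, toRotation_neg, hδ.map_inf, e.map_sup, one_inf, inf_one]

theorem localRep_eq_iff [CompactSpace S] (u v : Clopens S) (x y : A) :
    localRep ν δ (u, x) = localRep ν δ (v, y) ↔
      u = v ∧ ν uᶜ x = ν uᶜ y ∧ ν u (δ x) = ν u (δ y) := by
  constructor
  · intro h
    have key : ∀ p, ∃ W : Clopens S, p ∉ W ∧
        toRotation δ (p ∈ u) (ν W x) = toRotation δ (p ∈ v) (ν W y) := fun p =>
      let ⟨U, hU, h'⟩ := Germ.coe_eq.1 h p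
      ⟨U, hU, h' U le_rfl hU⟩
    -- High and low elements are never equal, so the germ determines the clopen set.
    obtain rfl : u = v := by
      ext p
      obtain ⟨W, -, hW⟩ := key p
      by_cases h : p ∈ u <;> by_cases k : p ∈ v <;> simp [toRotation, h, k] at hW ⊢
    refine ⟨rfl, hν.eq_of_forall_exists fun p hp => ?_, ?_⟩
    · obtain ⟨W, hW, h'⟩ := key p
      rw [toRotation_pos hp, toRotation_pos hp] at h'
      exact ⟨W, hW, Rotation.high.inj h'⟩
    · have := hν.eq_of_forall_exists (U := uᶜ) (x := δ x) (y := δ y) fun p hp => by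
        obtain ⟨W, hW, h'⟩ := key p
        have hp' : p ∉ u := hp
        rw [toRotation_neg hp', toRotation_neg hp'] at h'
        exact ⟨W, hW, by rw [hν.comm_nucleus, hν.comm_nucleus]; exact Rotation.low.inj h'⟩
      rwa [compl_compl] at this
  · rintro ⟨rfl, h, h'⟩
    refine Germ.coe_eq.2 ?_
    filter_upwards [hν.eventually_comp uᶜ x, hν.eventually_comp uᶜ y, hν.eventually_comp u (δ x),
      hν.eventually_comp u (δ y)] with j h1 h2 h3 h4
    by_cases hj : j.1 ∈ u
    · rw [if_neg fun h : j.1 ∈ uᶜ => h hj] at h1 h2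
      rw [toRotation_pos hj, toRotation_pos hj, ← h1, ← h2, h]
    · rw [if_neg hj] at h3 h4
      rw [toRotation_neg hj, toRotation_neg hj]
      exact Rotation.low_congr (by
        rw [← hν.comm_nucleus (δ := δ), ← hν.comm_nucleus (δ := δ), ← h3, ← h4, h'])

/-- The algebra `B ⊗ₑ^δ A` exists and is an SBP-algebra, for `B` the algebra of clopen subsets of
a compact space. -/
theorem exists_isTensor [CompactSpace S] (δ : A → A) [hδ : IsLatticeNucleus δ] :
    ∃ (L : Type (max u v)) (_ : SBPAlgebra L) (q : Clopens S × A → L), IsTensor ν δ q := by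
  -- The quotient by `∼` is realized as the range of `localRep`, whose kernel is `∼`.
  let s : Set (Germ (localFilter S) (Rotation δ)) := Set.range (localRep ν δ)
  have one : localRep ν δ (⊤, 1) = 1 := congrArg _ (funext fun j => by
    exact (toRotation_pos trivial _).trans (congrArg _ (hν.map_one _)))
  have bot : localRep ν δ (⊥, 1) = ⊥ := congrArg _ (funext fun j => by
    exact (toRotation_neg (fun h => h) _).trans <|
      Rotation.low_congr (by rw [hν.map_one, hδ.map_one]))
  let inst : SBPAlgebra s := SBPAlgebra.ofClosed s
    (by rintro _ ⟨a, rfl⟩ _ ⟨b, rfl⟩; exact ⟨_, (localRep_mul hν _ _ _ _).symm⟩)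
    (by rintro _ ⟨a, rfl⟩ _ ⟨b, rfl⟩; exact ⟨_, (localRep_himp hν _ _ _ _).symm⟩)
    (by rintro _ ⟨a, rfl⟩ _ ⟨b, rfl⟩; exact ⟨_, (localRep_inf hν _ _ _ _).symm⟩)
    (by rintro _ ⟨a, rfl⟩ _ ⟨b, rfl⟩; exact ⟨_, (localRep_sup hν _ _ _ _).symm⟩)
    ⟨_, bot⟩ ⟨_, one⟩
  exact ⟨s, inst, Set.rangeFactorization (localRep ν δ),
    { surjective := Set.rangeFactorization_surjective
      eq_iff := fun u x v y => Subtype.ext_iff.trans (localRep_eq_iff hν u v x y)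
      map_mul := fun u x v y => Subtype.ext (localRep_mul hν u v x y)
      map_himp := fun u x v y => Subtype.ext (localRep_himp hν u v x y)
      map_inf := fun u x v y => Subtype.ext (localRep_inf hν u v x y)
      map_sup := fun u x v y => Subtype.ext (localRep_sup hν u v x y)
      map_bot := Subtype.ext bot
      map_one := Subtype.ext one }⟩

end
end IsExternalJoin
end MTLDuality

namespace MTLDuality
open GMTLAlgebra TopologicalSpace

/-! ## Points of a `GMTL^τ`-space and prime filters -/

namespace Ups

section
variable {X : Type*} [TopologicalSpace X] [PartialOrder X] [OrderTop X]

theorem mem_inf {U V : Ups X} {x : X} : x ∈ (U ⊓ V).carrier ↔ x ∈ U.carrier ∧ x ∈ V.carrier :=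
  Iff.rfl

theorem mem_sup {U V : Ups X} {x : X} : x ∈ (U ⊔ V).carrier ↔ x ∈ U.carrier ∨ x ∈ V.carrier :=
  Iff.rfl

omit [OrderTop X] in
theorem le_of_forall_mem [PriestleySpace X] {x y : X}
    (h : ∀ V : Ups X, x ∈ V.carrier → y ∈ V.carrier) : x ≤ y := by
  by_contra hn
  obtain ⟨U, hU, hU', hx, hy⟩ := exists_isClopen_upper_of_not_le hn
  exact hy (h ⟨U, hU, hU', ⟨x, hx⟩⟩ hx)

omit [OrderTop X] in
theorem eq_of_forall_mem_iff [PriestleySpace X] {x y : X}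
    (h : ∀ V : Ups X, x ∈ V.carrier ↔ y ∈ V.carrier) : x = y :=
  le_antisymm (le_of_forall_mem fun V => (h V).1) (le_of_forall_mem fun V => (h V).2)

theorem exists_notMem [PriestleySpace X] {x : X} (hx : x ≠ ⊤) : ∃ V : Ups X, x ∉ V.carrier := by
  by_contra! h
  exact hx (top_le_iff.1 (le_of_forall_mem fun V _ => h V))

/-- A possibly improper prime filter of nonempty clopen up-sets is given by a point. -/
theorem exists_point [CompactSpace X] (P : Set (Ups X)) (hne : P.Nonempty)
    (hup : ∀ U ∈ P, ∀ V, U ≤ V → V ∈ P) (hinf : ∀ U ∈ P, ∀ V ∈ P, U ⊓ V ∈ P)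
    (hsup : ∀ U V, U ⊔ V ∈ P → U ∈ P ∨ V ∈ P) : ∃ x, ∀ V : Ups X, x ∈ V.carrier ↔ V ∈ P := by
  -- A proper `P` gives a directed family of nonempty closed sets `U \ V` with `U ∈ P` and `V ∉ P`,
  -- and compactness provides a common point. The improper one corresponds to `⊤`.
  by_cases hall : ∃ V, V ∉ P
  · obtain ⟨V₀, hV₀⟩ := hall
    obtain ⟨U₀, hU₀⟩ := hne
    let t : {p : Ups X × Ups X // p.1 ∈ P ∧ p.2 ∉ P} → Set X := fun p =>
      p.1.1.carrier ∩ p.1.2.carrierᶜ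
    have hcl : ∀ i, IsClosed (t i) := fun i => i.1.1.isClopen.isClosed.inter
      i.1.2.isClopen.compl.isClosed
    have : Nonempty {p : Ups X × Ups X // p.1 ∈ P ∧ p.2 ∉ P} := ⟨⟨(U₀, V₀), hU₀, hV₀⟩⟩
    obtain ⟨x, hx⟩ := IsCompact.nonempty_iInter_of_directed_nonempty_isCompact_isClosed t
      (fun i j => ⟨⟨(i.1.1 ⊓ j.1.1, i.1.2 ⊔ j.1.2), hinf _ i.2.1 _ j.2.1,
        fun h => (hsup _ _ h).elim i.2.2 j.2.2⟩,
        fun x hx => ⟨hx.1.1, fun h => hx.2 (Or.inl h)⟩,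
        fun x hx => ⟨hx.1.2, fun h => hx.2 (Or.inr h)⟩⟩)
      (fun i => Set.inter_compl_nonempty_iff.2 fun h => i.2.2 (hup _ i.2.1 _ h))
      (fun i => (hcl i).isCompact) hcl
    rw [Set.mem_iInter] at hx
    refine ⟨x, fun V => ⟨fun hV => ?_, fun hV => (hx ⟨(V, V₀), hV, hV₀⟩).1⟩⟩
    by_contra hn
    exact (hx ⟨(U₀, V), hU₀, hn⟩).2 hV
  · exact ⟨⊤, fun V => iff_of_true V.top_mem (by_contra fun h => hall ⟨V, h⟩)⟩

end

/-! ### Existence of `x • y` and `x ⇒ y` -/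

section
open ResiduatedSpace
variable {X : Type*} [TopologicalSpace X] [PartialOrder X] [OrderTop X] [GMTLSpace X] {x y z : X}

theorem mem_mul_of_R {U V : Ups X} (hx : x ∈ U.carrier) (hy : y ∈ V.carrier) (h : R x y z) :
    z ∈ (U * V).carrier := ⟨x, hx, y, hy, h⟩

theorem mem_of_mem_himp {U V : Ups X} (hx : x ∈ (U ⇨ V).carrier) (hy : y ∈ U.carrier)
    (h : R x y z) : z ∈ V.carrier := hx ⟨x, rfl, y, hy, h⟩

omit [GMTLSpace X] in
theorem mem_one : x ∈ (1 : Ups X).carrier := trivial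

theorem R_iff : R x y z ↔ ∀ U V : Ups X, x ∈ U.carrier → y ∈ V.carrier → z ∈ (U * V).carrier := by
  refine ⟨fun h U V hx hy => mem_mul_of_R hx hy h, fun h => ?_⟩
  by_contra hn
  obtain ⟨U, V, hx, hy, hz⟩ := ResiduatedSpace.sep x y z hn
  exact hz (h ⟨U, U.isClopen, U.upper, ⟨x, hx⟩⟩ ⟨V, V.isClopen, V.upper, ⟨y, hy⟩⟩ hx hy)

/-- The required point corresponds to the filter generated by the products `U * V` with `x ∈ U` and
`y ∈ V`. It is prime because `U * V ≤ W ⊔ W'` gives `V ≤ (U ⇨ W) ⊔ (U ⇨ W')`, and `y` lies in one of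
the two residuals. -/
theorem exists_isLeast_R (x y : X) : ∃ z, IsLeast {z | R x y z} z := by
  obtain ⟨z, hz⟩ := exists_point
    {W : Ups X | ∃ U V : Ups X, x ∈ U.carrier ∧ y ∈ V.carrier ∧ U * V ≤ W}
    ⟨1, 1, 1, mem_one, mem_one, le_one _⟩
    (fun W ⟨U, V, hU, hV, h⟩ W' h' => ⟨U, V, hU, hV, h.trans h'⟩)
    (fun W ⟨U, V, hU, hV, h⟩ W' ⟨U', V', hU', hV', h'⟩ => ⟨U ⊓ U', V ⊓ V', ⟨hU, hU'⟩, ⟨hV, hV'⟩,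
      le_inf (((mul_le_mul_l inf_le_left _).trans (mul_le_mul_r inf_le_left _)).trans h)
        (((mul_le_mul_l inf_le_right _).trans (mul_le_mul_r inf_le_right _)).trans h')⟩)
    (by
      rintro W W' ⟨U, V, hU, hV, h⟩
      rcases himp_sup_le U W W' (mul_le_iff.1 h hV) with h | h
      · exact Or.inl ⟨U, U ⇨ W, hU, h, mul_himp_le U W⟩
      · exact Or.inr ⟨U, U ⇨ W', hU, h, mul_himp_le U W'⟩)
  refine ⟨z, R_iff.2 fun U V hU hV => (hz _).2 ⟨U, V, hU, hV, le_rfl⟩, fun w hw =>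
    le_of_forall_mem fun W hW => ?_⟩
  obtain ⟨U, V, hU, hV, h⟩ := (hz W).1 hW
  exact h (mem_mul_of_R hU hV hw)

/-- The point corresponds to the filter of all `U` with `y ∈ U * V` for every `V ∋ x`. The
hypothesis `x ≤ y` says that this filter contains `1`; closure under meets is `inf_mul_le`. -/
theorem exists_isGreatest_R (h : x ≤ y) : ∃ z, IsGreatest {z | R z x y} z := by
  obtain ⟨z, hz⟩ := exists_point
    {U : Ups X | ∀ V : Ups X, x ∈ V.carrier → y ∈ (U * V).carrier}
    ⟨1, fun V hV => by rw [one_mul]; exact V.isUpper h hV⟩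
    (fun U hU W hW V hV => mul_le_mul_r hW V (hU V hV))
    (fun U hU W hW V hV => inf_mul_le U W V ⟨hU V hV, hW V hV⟩)
    (by
      intro U W h
      by_contra! hn
      simp only [Set.mem_ofPred_eq, not_forall] at hn
      obtain ⟨⟨V, hV, hn⟩, V', hV', hn'⟩ := hn
      have hm := h (V ⊓ V') ⟨hV, hV'⟩
      rw [mul_comm, GMTLAlgebra.mul_sup] at hm
      rcases hm with hm | hm
      · exact hn (by rw [mul_comm]; exact mul_le_mul_r inf_le_left U hm)
      · exact hn' (by rw [mul_comm]; exact mul_le_mul_r inf_le_right W hm))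
  refine ⟨z, R_iff.2 fun U V hU hV => (hz U).1 hU V hV, fun w hw =>
    le_of_forall_mem fun U hU => (hz U).2 fun V hV => mem_mul_of_R hU hV hw⟩

end
end Ups

/-! ## Points of a dual quadruple -/

namespace DualQuadruple
open ResiduatedSpace

variable {S : Type u} {X : Type v}
  [TopologicalSpace S] [CompactSpace S] [T2Space S] [TotallyDisconnectedSpace S]
  [TopologicalSpace X] [PartialOrder X] [OrderTop X] [GMTLSpace X]
  (Q : DualQuadruple S X)

theorem isExternalJoin : IsExternalJoin Q.ν := Q.externalJoin

theorem mem_δ {V : Ups X} {x : X} : x ∈ (Q.δ V).carrier ↔ Q.Δ x ∈ V.carrier := Iff.rfl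

theorem mem_ν {U : Clopens S} {V : Ups X} {x : X} :
    x ∈ (Q.ν U V).carrier ↔ (Q.υ U).toFun x ∈ V.carrier := Iff.rfl

instance : IsLatticeNucleus Q.δ where
  le V _ hx := V.isUpper (Q.Δ.le_closure _) hx
  idem V := Ups.ext (Set.ext fun x => by rw [mem_δ, mem_δ, mem_δ, Q.Δ.idempotent])
  map_inf _ _ := rfl
  map_sup _ _ := rfl
  mul_le _ _ := fun _ ⟨_, hx, _, hy, h⟩ => Ups.mem_mul_of_R hx hy (Q.Δ_R _ _ _ h)

theorem mem_image_Δ {V : Ups X} {x : X} (hx : Q.Δ x = x) :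
    x ∈ Q.Δ '' V.carrier ↔ x ∈ V.carrier :=
  ⟨fun ⟨_, hy, h⟩ => h ▸ V.isUpper (Q.Δ.le_closure _) hy, fun h => ⟨x, h, hx⟩⟩

/-- Since `ν U W ⊔ ν Uᶜ V = 1` for all `W` and `V`, a set `V` missing `υ_{Uᶜ} x` and a set `W`
missing `υ_U x` cannot both exist. -/
theorem υ_eq_top_of_compl {U : Clopens S} {x : X} (h : (Q.υ Uᶜ).toFun x ≠ ⊤) :
    (Q.υ U).toFun x = ⊤ := by
  by_contra hn
  obtain ⟨V, hV⟩ := Ups.exists_notMem h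
  obtain ⟨W, hW⟩ := Ups.exists_notMem hn
  have key := Q.isExternalJoin.sup_eq U Uᶜ W V
  rw [sup_compl_eq_top, Q.isExternalJoin.top_left] at key
  have hx : x ∈ (Q.ν U W ⊔ Q.ν Uᶜ V).carrier := key ▸ Ups.mem_one
  exact hx.elim hW hV

theorem υ_eq_self_of_compl {U : Clopens S} {x : X} (h : (Q.υ Uᶜ).toFun x = ⊤) :
    (Q.υ U).toFun x = x :=
  Ups.eq_of_forall_mem_iff fun V => by
    conv_rhs => rw [← Q.isExternalJoin.inf_compl U V]
    rw [Ups.mem_inf, mem_ν, mem_ν, h]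
    exact (and_iff_left V.top_mem).symm

theorem υ_eq_top_or_self (U : Clopens S) (x : X) :
    (Q.υ U).toFun x = ⊤ ∨ (Q.υ U).toFun x = x := by
  by_cases h : (Q.υ Uᶜ).toFun x = ⊤
  · exact Or.inr (Q.υ_eq_self_of_compl h)
  · exact Or.inl (Q.υ_eq_top_of_compl h)

theorem fixes_top (u : S) : Q.Fixes u ⊤ := fun U _ => (Q.υ U).map_top

variable {Q} in
theorem Fixes.υ_eq_top {u : S} {x : X} (h : Q.Fixes u x) {U : Clopens S} (hu : u ∈ U) :
    (Q.υ U).toFun x = ⊤ := by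
  by_cases hx : x = ⊤
  · rw [hx, (Q.υ U).map_top]
  · exact Q.υ_eq_top_of_compl (by rwa [h Uᶜ fun h => h hu])

variable {Q} in
-- The pointwise form of the external join: at a point fixed by `u`, applying `ν U` amounts to a
-- disjunction with `u ∈ U`.
theorem Fixes.mem_ν {u : S} {x : X} (h : Q.Fixes u x) {U : Clopens S} {V : Ups X} :
    x ∈ (Q.ν U V).carrier ↔ u ∈ U ∨ x ∈ V.carrier := by
  rw [Q.mem_ν]
  by_cases hu : u ∈ U
  · rw [h.υ_eq_top hu]
    exact iff_of_true V.top_mem (Or.inl hu)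
  · rw [h U hu, or_iff_right hu]

variable {Q} in
theorem Fixes.mono {u : S} {x y : X} (h : Q.Fixes u x) (hxy : x ≤ y) : Q.Fixes u y := by
  intro U hU
  have key := (Q.υ Uᶜ).monotone hxy
  rw [h.υ_eq_top (U := Uᶜ) hU] at key
  exact Q.υ_eq_self_of_compl (top_le_iff.1 key)

variable {Q} in
theorem Fixes.of_le {u : S} {x y : X} (h : Q.Fixes u y) (hy : y ≠ ⊤) (hxy : x ≤ y) :
    Q.Fixes u x := by
  intro U hU
  refine (Q.υ_eq_top_or_self U x).resolve_left fun htop => hy ?_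
  have key := (Q.υ U).monotone hxy
  rwa [htop, h U hU, top_le_iff] at key

/-- If no `u` fixes `x`, then every `u` misses some `U` with `υ_U x = ⊤`. Such sets are closed under
meets, so compactness of `S` makes `⊥` one of them; but `υ_⊥` is the identity, whence `x = ⊤`. -/
theorem exists_fixes {x : X} (hx : x ≠ ⊤) : ∃ u, Q.Fixes u x := by
  by_contra! hn
  obtain ⟨U, hU, hU'⟩ := IsExternalJoin.exists_le_compl (p := fun U => (Q.υ U).toFun x = ⊤)
    (Ups.eq_of_forall_mem_iff fun V => iff_of_true (by
      rw [← mem_ν, Q.isExternalJoin.top_left]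
      exact Ups.mem_one) V.top_mem)
    (fun U U' h h' => Ups.eq_of_forall_mem_iff fun V => iff_of_true (by
      rw [← mem_ν, Q.isExternalJoin.map_inf_left, Ups.mem_inf, mem_ν, mem_ν, h, h']
      exact ⟨V.top_mem, V.top_mem⟩) V.top_mem) ⊤ (fun u _ => by
      have hu := hn u
      simp only [Fixes, not_forall] at hu
      obtain ⟨U, hU, h⟩ := hu
      exact ⟨U, hU, (Q.υ_eq_top_or_self U x).resolve_right h⟩)
  rw [compl_top, le_bot_iff] at hU
  subst hU
  refine hx (Eq.trans (Ups.eq_of_forall_mem_iff fun V => ?_) hU')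
  rw [← mem_ν, Q.isExternalJoin.bot_left]

/-- When `υ_U x ≠ ⊤`, the point `x` is fixed by `υ_U` and by some `u`, and `u ∈ U` would force `υ_U
x = ⊤`. So inequalities between values of `ν U` may be tested at points fixed by some `u` outside
`U`. -/
theorem ν_le_ν {U : Clopens S} {V W : Ups X}
    (h : ∀ u x, Q.Fixes u x → u ∉ U → x ∈ V.carrier → x ∈ W.carrier) : Q.ν U V ≤ Q.ν U W := by
  intro x hx
  rw [mem_ν] at hx ⊢
  by_cases htop : (Q.υ U).toFun x = ⊤
  · rw [htop]; exact W.top_mem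
  · obtain ⟨u, hu⟩ := Q.exists_fixes htop
    have hself := (Q.υ_eq_top_or_self U x).resolve_left htop
    refine h u _ hu (fun hU => htop ?_) hx
    have := hu.υ_eq_top hU
    rwa [hself] at this

end DualQuadruple
end MTLDuality

namespace MTLDuality
open GMTLAlgebra TopologicalSpace

namespace DualQuadruple
open ResiduatedSpace

variable {S : Type u} {X : Type v}
  [TopologicalSpace S] [CompactSpace S] [T2Space S] [TotallyDisconnectedSpace S]
  [TopologicalSpace X] [PartialOrder X] [OrderTop X] [GMTLSpace X]
  {Q : DualQuadruple S X}

/-! ## The space `S ⊗ X` -/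

theorem clopens_separate {u v : S}
    (h : ∀ U : Clopens S, u ∈ U → v ∈ U) : u = v := by
  by_contra hn
  obtain ⟨U, hU, hu, hv⟩ := exists_isClopen_of_totally_separated hn
  exact hv (h ⟨U, hU⟩ hu)

namespace Space

/-- The point `(u, x)`. -/
def low (u : S) (x : X) (h : Q.Fixes u x) : Q.Space := Sum.inl ⟨(u, x), h⟩

/-- The point `+(u, x)`. -/
def up (u : S) (x : X) (h : Q.Fixes u x) (hΔ : Q.Δ x = x) (hx : x ≠ ⊤) : Q.Space :=
  Sum.inr ⟨(u, x), x, h, by rwa [hΔ], hΔ.symm⟩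

theorem eq_low_or_eq_up (t : Q.Space) :
    (∃ u x h, t = low u x h) ∨ ∃ u x h hΔ hx, t = up u x h hΔ hx := by
  rcases t with ⟨⟨u, x⟩, h⟩ | ⟨⟨u, x⟩, y, h, hy, hxy⟩
  · exact Or.inl ⟨u, x, h, rfl⟩
  · cases hxy
    exact Or.inr ⟨u, Q.Δ y, h.mono (Q.Δ.le_closure y), Q.Δ.idempotent y, hy, rfl⟩

section
variable {u v w : S} {x y z : X} {hx : Q.Fixes u x} {hy : Q.Fixes v y} {hz : Q.Fixes w z}
  {hx' : Q.Δ x = x} {hx'' : x ≠ ⊤} {hy' : Q.Δ y = y} {hy'' : y ≠ ⊤} {hz' : Q.Δ z = z}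
  {hz'' : z ≠ ⊤} {U U' : Clopens S} {V V' : Ups X}

theorem low_mem_W : low u x hx ∈ W U V ↔ u ∈ U ∧ x ∈ V.carrier := Iff.rfl

theorem up_mem_W : up u x hx hx' hx'' ∈ W U V ↔ u ∈ U ∨ x ∉ V.carrier := by
  rw [← Q.mem_image_Δ hx']
  exact Iff.rfl

theorem low_le_low : low u x hx ≤ low v y hy ↔ u = v ∧ x ≤ y := Iff.rfl

theorem low_le_up : low u x hx ≤ up v y hy hy' hy'' ↔ u = v := Iff.rfl

theorem not_up_le_low : ¬ up u x hx hx' hx'' ≤ low v y hy := fun h => h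

theorem up_le_up : up u x hx hx' hx'' ≤ up v y hy hy' hy'' ↔ u = v ∧ y ≤ x := Iff.rfl

theorem Rel_comm {p q r : Q.Space} : Rel p q r ↔ Rel q p r := by
  refine exists_congr fun s => and_congr_left fun _ => ?_
  rcases p with ⟨⟨u, x⟩, hx⟩ | ⟨⟨u, x⟩, hx⟩ <;> rcases q with ⟨⟨v, y⟩, hy⟩ | ⟨⟨v, y⟩, hy⟩ <;>
    rcases s with ⟨⟨w, z⟩, hz⟩ | ⟨⟨w, z⟩, hz⟩ <;> try exact Iff.rfl
  simp only [Circ, MTLSpace.R_comm x y]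
  constructor <;> rintro ⟨rfl, rfl, h⟩ <;> exact ⟨rfl, rfl, h⟩

theorem Rel_low_low {r : Q.Space} : Rel (low u x hx) (low v y hy) r ↔
    u = v ∧ ∃ z hz, R x y z ∧ low u z hz ≤ r := by
  constructor
  · rintro ⟨⟨⟨w, z⟩, hz⟩ | ⟨⟨w, z⟩, hz⟩, h, hr⟩
    · obtain ⟨rfl, rfl, h⟩ := h
      exact ⟨rfl, z, hz, h.1, hr⟩
    · exact h.elim
  · rintro ⟨rfl, z, hz, h, hr⟩
    obtain ⟨m, hm⟩ := Ups.exists_isLeast_R x y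
    refine ⟨low u m (hx.mono (Ups.le_of_R hm.1)), ⟨rfl, rfl, hm⟩, le_trans ?_ hr⟩
    exact ⟨rfl, hm.2 h⟩

theorem Rel_low_low_low :
    Rel (low u x hx) (low v y hy) (low w z hz) ↔ u = v ∧ u = w ∧ R x y z := by
  rw [Rel_low_low]
  constructor
  · rintro ⟨rfl, m, hm, h, rfl, hr⟩
    exact ⟨rfl, rfl, mono le_rfl le_rfl hr h⟩
  · rintro ⟨rfl, rfl, h⟩
    exact ⟨rfl, z, hz, h, le_rfl⟩

theorem Rel_low_low_up :
    Rel (low u x hx) (low v y hy) (up w z hz hz' hz'') ↔ u = v ∧ u = w := by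
  rw [Rel_low_low]
  constructor
  · rintro ⟨rfl, m, hm, h, hr⟩
    exact ⟨rfl, hr⟩
  · rintro ⟨rfl, rfl⟩
    obtain ⟨m, hm⟩ := Ups.exists_isLeast_R x y
    exact ⟨rfl, m, hx.mono (Ups.le_of_R hm.1), hm.1, rfl⟩

theorem not_Rel_low_up_low :
    ¬ Rel (low u x hx) (up v y hy hy' hy'') (low w z hz) := by
  rintro ⟨s | s, h, hr⟩
  · exact h
  · exact hr

theorem Rel_low_up_up :
    Rel (low u x hx) (up v y hy hy' hy'') (up w z hz hz' hz'') ↔ u = v ∧ u = w ∧ R z x y := by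
  constructor
  · rintro ⟨⟨⟨t, m⟩, hm⟩ | ⟨⟨t, m⟩, hm⟩, h, hr⟩
    · exact h.elim
    · obtain ⟨rfl, rfl, -, h⟩ := h
      obtain ⟨rfl, hr⟩ := hr
      have hm := h.1
      simp only [Set.mem_ofPred_eq] at hm
      exact ⟨rfl, rfl, mono hr le_rfl hy'.le hm⟩
  · rintro ⟨rfl, rfl, h⟩
    have hxy : x ≤ y := Ups.le_of_R ((MTLSpace.R_comm _ _ _).1 h)
    obtain ⟨m, hm⟩ := Ups.exists_isGreatest_R hxy
    have hle : m ≤ y := Ups.le_of_R hm.1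
    have hΔ : Q.Δ m = m := by
      refine le_antisymm (hm.2 ?_) (Q.Δ.le_closure m)
      have := Q.Δ_R _ _ _ hm.1
      rw [hy'] at this
      exact mono le_rfl (Q.Δ.le_closure x) le_rfl this
    refine ⟨up u m (hy.of_le hy'' hle) hΔ fun h => hy'' (top_le_iff.1 (h ▸ hle)), ?_, rfl, hm.2 h⟩
    refine ⟨rfl, rfl, ?_, ?_⟩
    · exact hxy.trans hy'.ge
    · change IsGreatest {z | R z x (Q.Δ y)} m
      rwa [hy']

theorem not_Rel_up_up {r : Q.Space} :
    ¬ Rel (up u x hx hx' hx'') (up v y hy hy' hy'') r := by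
  rintro ⟨s | s, h, -⟩ <;> exact h

end

/-! ## The sets `W U V` -/

theorem W_top_one : (W ⊤ 1 : Set Q.Space) = Set.univ := by
  ext t
  rcases t.eq_low_or_eq_up with ⟨u, x, hx, rfl⟩ | ⟨u, x, hx, hx', hx'', rfl⟩
  · exact iff_of_true ⟨trivial, trivial⟩ trivial
  · exact iff_of_true (up_mem_W.2 (Or.inl trivial)) trivial

theorem W_bot_one : (W ⊥ 1 : Set Q.Space) = ∅ := by
  ext t
  rcases t.eq_low_or_eq_up with ⟨u, x, hx, rfl⟩ | ⟨u, x, hx, hx', hx'', rfl⟩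
  · exact iff_of_false (fun h => h.1) fun h => h
  · exact iff_of_false (fun h => (up_mem_W.1 h).elim (fun h => h) fun h => h trivial) fun h => h

open IsExternalJoin in
-- `Fixes.mem_ν` reduces the equality to a propositional check in each of the four cases for
-- membership of the first coordinate in `u` and `v`.
theorem W_inter (u v : Clopens S) (x y : Ups X) :
    (W u x ∩ W v y : Set Q.Space) = W (u ⊓ v) (Q.ν (u ⊔ v) (x ⊔ y) ⊓ Q.ν (u ⊔ vᶜ) x ⊓
      Q.ν (uᶜ ⊔ v) y ⊓ Q.ν (uᶜ ⊔ vᶜ) (x ⊓ y)) := by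
  ext t
  rcases t.eq_low_or_eq_up with ⟨p, z, hz, rfl⟩ | ⟨p, z, hz, hz', hz'', rfl⟩ <;>
    simp only [Set.mem_inter_iff, low_mem_W, up_mem_W, Ups.mem_inf, hz.mem_ν, Ups.mem_sup, mem_inf,
      mem_sup, mem_compl] <;> by_cases h : p ∈ u <;> by_cases k : p ∈ v <;> simp [h, k]

open IsExternalJoin in
theorem W_union (u v : Clopens S) (x y : Ups X) :
    (W u x ∪ W v y : Set Q.Space) = W (u ⊔ v) (Q.ν (u ⊔ v) (x ⊓ y) ⊓ Q.ν (u ⊔ vᶜ) y ⊓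
      Q.ν (uᶜ ⊔ v) x ⊓ Q.ν (uᶜ ⊔ vᶜ) (x ⊔ y)) := by
  ext t
  rcases t.eq_low_or_eq_up with ⟨p, z, hz, rfl⟩ | ⟨p, z, hz, hz', hz'', rfl⟩ <;>
    simp only [Set.mem_union, low_mem_W, up_mem_W, Ups.mem_inf, hz.mem_ν, Ups.mem_sup, mem_sup,
      mem_compl] <;> by_cases h : p ∈ u <;> by_cases k : p ∈ v <;>
      simp [h, k, or_comm, imp_iff_not_or]

theorem W_subset_fst {u v : Clopens S} {x y : Ups X} (h : (W u x : Set Q.Space) ⊆ W v y) :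
    u ≤ v := fun p hp =>
  (h (low_mem_W (hx := Q.fixes_top p) |>.2 ⟨hp, x.top_mem⟩)).1

/-- Inclusion is tested at the points `(p, z)` and `+(p, Δ z)`; by `ν_le_ν` these suffice. The
second inequality is reversed because upper points enter `W` through non-membership. -/
theorem ν_le_of_W_subset {u : Clopens S} {x y : Ups X} (h : (W u x : Set Q.Space) ⊆ W u y) :
    Q.ν uᶜ x ≤ Q.ν uᶜ y ∧ Q.ν u (Q.δ y) ≤ Q.ν u (Q.δ x) := by
  refine ⟨Q.ν_le_ν fun p z hz hp hx => ?_, Q.ν_le_ν fun p z hz hp hy => ?_⟩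
  · exact (h (low_mem_W (hx := hz) |>.2 ⟨not_not.1 hp, hx⟩)).2
  · rw [mem_δ] at hy ⊢
    by_contra hx
    have htop : Q.Δ z ≠ ⊤ := fun h => hx (h ▸ x.top_mem)
    have key := h (up_mem_W (hx := hz.mono (Q.Δ.le_closure z)) (hx' := Q.Δ.idempotent z)
      (hx'' := htop) |>.2 (Or.inr hx))
    exact (up_mem_W.1 key).elim hp fun h => h hy

theorem W_eq_iff {u v : Clopens S} {x y : Ups X} : (W u x : Set Q.Space) = W v y ↔
    u = v ∧ Q.ν uᶜ x = Q.ν uᶜ y ∧ Q.ν u (Q.δ x) = Q.ν u (Q.δ y) := by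
  constructor
  · intro h
    obtain rfl : u = v := le_antisymm (W_subset_fst h.subset) (W_subset_fst h.superset)
    have h1 := ν_le_of_W_subset h.subset
    have h2 := ν_le_of_W_subset h.superset
    exact ⟨rfl, le_antisymm h1.1 h2.1, le_antisymm h2.2 h1.2⟩
  · rintro ⟨rfl, h1, h2⟩
    ext t
    rcases t.eq_low_or_eq_up with ⟨p, z, hz, rfl⟩ | ⟨p, z, hz, hz', hz'', rfl⟩
    · rw [low_mem_W, low_mem_W]
      refine and_congr_right fun hp => ?_
      have hp' : p ∉ uᶜ := fun h => h hp
      have := hz.mem_ν (U := uᶜ) (V := x)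
      rw [h1, hz.mem_ν, or_iff_right hp', or_iff_right hp'] at this
      exact this.symm
    · rw [up_mem_W, up_mem_W]
      refine or_congr_right' fun hp => not_congr ?_
      have := hz.mem_ν (U := u) (V := Q.δ x)
      rw [h2, hz.mem_ν, or_iff_right hp, or_iff_right hp, mem_δ, mem_δ, hz'] at this
      exact this.symm

/-- The sets `W U 1` detect the first coordinate, `W ⊤ V` the second coordinate of lower points, and
`W ⊥ V`, which contains no lower point, that of upper points. -/
theorem le_iff_forall_mem_W {p q : Q.Space} : p ≤ q ↔ ∀ U V, p ∈ W U V → q ∈ W U V := by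
  rcases p.eq_low_or_eq_up with ⟨u, x, hx, rfl⟩ | ⟨u, x, hx, hx', hx'', rfl⟩ <;>
    rcases q.eq_low_or_eq_up with ⟨v, y, hy, rfl⟩ | ⟨v, y, hy, hy', hy'', rfl⟩
  · simp only [low_le_low, low_mem_W]
    constructor
    · rintro ⟨rfl, h⟩ U V ⟨hU, hV⟩
      exact ⟨hU, V.isUpper h hV⟩
    · exact fun h => ⟨clopens_separate fun U hU => (h U 1 ⟨hU, trivial⟩).1,
        Ups.le_of_forall_mem fun V hV => (h ⊤ V ⟨trivial, hV⟩).2⟩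
  · simp only [low_le_up, low_mem_W, up_mem_W]
    constructor
    · rintro rfl U V ⟨hU, -⟩
      exact Or.inl hU
    · exact fun h => clopens_separate fun U hU =>
        (h U 1 ⟨hU, trivial⟩).resolve_right fun h => h trivial
  · refine iff_of_false not_up_le_low fun h => ?_
    obtain ⟨V, hV⟩ := Ups.exists_notMem hx''
    exact (h ⊥ V (up_mem_W.2 (Or.inr hV))).1
  · simp only [up_le_up, up_mem_W]
    constructor
    · rintro ⟨rfl, h⟩ U V (hU | hV)
      · exact Or.inl hU
      · exact Or.inr fun hy => hV (V.isUpper h hy)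
    · exact fun h => ⟨clopens_separate fun U hU =>
        (h U 1 (Or.inl hU)).resolve_right fun h => h trivial,
        Ups.le_of_forall_mem fun V hV => not_not.1 fun hx =>
          (h ⊥ V (Or.inr hx)).elim (fun h => h) fun h => h hV⟩

/-- The second coordinate of the product `[U, V] ⊙ [U', V']`. -/
def mulSnd (Q : DualQuadruple S X) (U : Clopens S) (V : Ups X) (U' : Clopens S) (V' : Ups X) :
    Ups X :=
  Q.ν (U ⊔ U'ᶜ) (V' ⇨ Q.δ V) ⊓ Q.ν (Uᶜ ⊔ U') (V ⇨ Q.δ V') ⊓ Q.ν (Uᶜ ⊔ U'ᶜ) (V * V')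

open IsExternalJoin in
theorem mem_mulSnd {u : S} {x : X} (hx : Q.Fixes u x) {U U' : Clopens S} {V V' : Ups X} :
    x ∈ (mulSnd Q U V U' V').carrier ↔
      (u ∉ U → u ∈ U' → x ∈ (V' ⇨ Q.δ V).carrier) ∧ (u ∈ U → u ∉ U' → x ∈ (V ⇨ Q.δ V').carrier) ∧
        (u ∈ U → u ∈ U' → x ∈ (V * V').carrier) := by
  simp only [mulSnd, Ups.mem_inf, hx.mem_ν, mem_sup, mem_compl]
  tauto

end Space
end DualQuadruple
end MTLDuality

/-! ### The ternary relation in terms of the sets `W U V` -/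

namespace MTLDuality
open GMTLAlgebra TopologicalSpace

namespace DualQuadruple
open ResiduatedSpace

variable {S : Type u} {X : Type v}
  [TopologicalSpace S] [CompactSpace S] [T2Space S] [TotallyDisconnectedSpace S]
  [TopologicalSpace X] [PartialOrder X] [OrderTop X] [GMTLSpace X]
  {Q : DualQuadruple S X}

namespace Space

/-- `W U V` and `W U' V'` multiply into `W (U ⊓ U') (mulSnd Q U V U' V')`. -/
def MulRel (p q r : Q.Space) : Prop :=
  ∀ U V U' V', p ∈ W U V → q ∈ W U' V' → r ∈ W (U ⊓ U') (mulSnd Q U V U' V')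

theorem mulSnd_comm (U U' : Clopens S) (V V' : Ups X) :
    mulSnd Q U V U' V' = mulSnd Q U' V' U V := by
  simp only [mulSnd, sup_comm, inf_comm, mul_comm]

theorem MulRel_comm {p q r : Q.Space} : MulRel p q r ↔ MulRel q p r := by
  have key : ∀ {p q : Q.Space}, MulRel p q r → MulRel q p r := fun h U V U' V' hq hp => by
    rw [inf_comm, mulSnd_comm]
    exact h U' V' U V hp hq
  exact ⟨key, key⟩

section
variable {u v w : S} {x y z : X} {hx : Q.Fixes u x} {hy : Q.Fixes v y} {hz : Q.Fixes w z}
  {hx' : Q.Δ x = x} {hx'' : x ≠ ⊤} {hy' : Q.Δ y = y} {hy'' : y ≠ ⊤} {hz' : Q.Δ z = z}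
  {hz'' : z ≠ ⊤}

theorem mem_himp_δ_one (V : Ups X) : x ∈ (V ⇨ Q.δ 1).carrier := fun _ _ => trivial

open IsExternalJoin in
-- The classes `[U, 1]` and `[U', 1]` with `U`, `U'` disjoint multiply to `⊥`. This forces points
-- related by `MulRel` to have equal first coordinates.
theorem notMem_W_disjoint {U U' : Clopens S} (h : ∀ p ∈ U, p ∉ U') (r : Q.Space) :
    r ∉ W (U ⊓ U') (mulSnd Q U 1 U' 1) := by
  rcases r.eq_low_or_eq_up with ⟨w, z, hz, rfl⟩ | ⟨w, z, hz, hz', hz'', rfl⟩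
  · exact fun H => h w H.1.1 H.1.2
  · exact fun H => (up_mem_W.1 H).elim (fun H => h w H.1 H.2) fun H => H <| (mem_mulSnd hz).2
      ⟨fun _ _ => mem_himp_δ_one _, fun _ _ => mem_himp_δ_one _, fun h1 h2 => (h w h1 h2).elim⟩

theorem mem_of_mem_W_self {U : Clopens S} :
    (low w z hz ∈ W (U ⊓ U) (mulSnd Q U 1 U 1) → w ∈ U) ∧
      (up w z hz hz' hz'' ∈ W (U ⊓ U) (mulSnd Q U 1 U 1) → w ∈ U) := by
  refine ⟨fun H => H.1.1, fun H => (up_mem_W.1 H).elim And.left fun H => ?_⟩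
  by_contra hn
  exact H <| (mem_mulSnd hz).2 ⟨fun _ _ => mem_himp_δ_one _, fun _ _ => mem_himp_δ_one _,
    fun h1 => (hn h1).elim⟩

theorem MulRel_low_low_low :
    MulRel (low u x hx) (low v y hy) (low w z hz) ↔ u = v ∧ u = w ∧ R x y z := by
  constructor
  · intro H
    obtain rfl : u = v := clopens_separate fun U hU => by_contra fun hv =>
      notMem_W_disjoint (U' := Uᶜ) (fun _ h h' => h' h) _ (H U 1 Uᶜ 1 ⟨hU, trivial⟩ ⟨hv, trivial⟩)
    refine ⟨rfl, clopens_separate fun U hU => (H U 1 U 1 ⟨hU, trivial⟩ ⟨hU, trivial⟩).1.1,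
      Ups.R_iff.2 fun V V' hV hV' => ?_⟩
    exact ((mem_mulSnd hz).1 (H ⊤ V ⊤ V' ⟨trivial, hV⟩ ⟨trivial, hV'⟩).2).2.2 trivial trivial
  · rintro ⟨rfl, rfl, h⟩ U V U' V' ⟨hU, hV⟩ ⟨hU', hV'⟩
    exact ⟨⟨hU, hU'⟩, (mem_mulSnd hz).2 ⟨fun h => (h hU).elim, fun _ h => (h hU').elim,
      fun _ _ => Ups.mem_mul_of_R hV hV' h⟩⟩

theorem MulRel_low_low_up :
    MulRel (low u x hx) (low v y hy) (up w z hz hz' hz'') ↔ u = v ∧ u = w := by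
  constructor
  · intro H
    obtain rfl : u = v := clopens_separate fun U hU => by_contra fun hv =>
      notMem_W_disjoint (U' := Uᶜ) (fun _ h h' => h' h) _ (H U 1 Uᶜ 1 ⟨hU, trivial⟩ ⟨hv, trivial⟩)
    exact ⟨rfl, clopens_separate fun U hU =>
      (mem_of_mem_W_self (hz := hz)).2 (H U 1 U 1 ⟨hU, trivial⟩ ⟨hU, trivial⟩)⟩
  · rintro ⟨rfl, rfl⟩ U V U' V' ⟨hU, hV⟩ ⟨hU', hV'⟩
    exact up_mem_W.2 (Or.inl ⟨hU, hU'⟩)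

theorem not_MulRel_low_up_low :
    ¬ MulRel (low u x hx) (up v y hy hy' hy'') (low w z hz) := fun H => by
  obtain ⟨V, hV⟩ := Ups.exists_notMem hy''
  exact (H ⊤ 1 ⊥ V ⟨trivial, trivial⟩ (up_mem_W.2 (Or.inr hV))).1.2

theorem MulRel_low_up_up :
    MulRel (low u x hx) (up v y hy hy' hy'') (up w z hz hz' hz'') ↔
      u = v ∧ u = w ∧ R z x y := by
  constructor
  · intro H
    obtain rfl : u = v := clopens_separate fun U hU => by_contra fun hv =>
      notMem_W_disjoint (U' := Uᶜ) (fun _ h h' => h' h) _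
        (H U 1 Uᶜ 1 ⟨hU, trivial⟩ (up_mem_W.2 (Or.inl hv)))
    refine ⟨rfl, clopens_separate fun U hU => (mem_of_mem_W_self (hz := hz)).2
      (H U 1 U 1 ⟨hU, trivial⟩ (up_mem_W.2 (Or.inl hU))), Ups.R_iff.2 fun Z V hZ hV => ?_⟩
    by_contra hn
    -- The pair `[⊤, V]`, `[⊥, Z * V]` has product with second coordinate `V ⇨ δ (Z * V)` above `z`;
    -- this set contains `Z ∋ z`, so the upper point over `z` is not in the product.
    refine (up_mem_W.1 (H ⊤ V ⊥ (Z * V) ⟨trivial, hV⟩ (up_mem_W.2 (Or.inr hn)))).elim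
      (fun h => h.2) fun h => h <| (mem_mulSnd hz).2
        ⟨fun h => (h trivial).elim, fun _ _ => ?_, fun _ h => h.elim⟩
    have hle : V * Z ≤ Q.δ (Z * V) := by
      rw [mul_comm]
      exact IsLatticeNucleus.le _
    exact mul_le_iff.1 hle hZ
  · rintro ⟨rfl, rfl, h⟩ U V U' V' ⟨hU, hV⟩ hq
    rw [up_mem_W] at hq ⊢
    by_cases hU' : u ∈ U'
    · exact Or.inl ⟨hU, hU'⟩
    · refine Or.inr fun hm => hq.resolve_left hU' ?_
      have key := Ups.mem_of_mem_himp (((mem_mulSnd hz).1 hm).2.1 hU hU') hV h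
      rwa [mem_δ, hy'] at key

theorem not_MulRel_up_up {r : Q.Space} :
    ¬ MulRel (up u x hx hx' hx'') (up v y hy hy' hy'') r := fun H => by
  obtain ⟨V, hV⟩ := Ups.exists_notMem hx''
  obtain ⟨V', hV'⟩ := Ups.exists_notMem hy''
  have key := H ⊥ V ⊥ V' (up_mem_W.2 (Or.inr hV)) (up_mem_W.2 (Or.inr hV'))
  rcases r.eq_low_or_eq_up with ⟨w, z, hz, rfl⟩ | ⟨w, z, hz, hz', hz'', rfl⟩
  · exact key.1.1
  · exact (up_mem_W.1 key).elim (fun h => h.1) fun h => h <| (mem_mulSnd hz).2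
      ⟨fun _ h => h.elim, fun h => h.elim, fun h => h.elim⟩

end

/-- `MulRel` is inclusion of the filter product in the third filter, written on classes. Both
relations reduce to the same conditions on coordinates for each combination of lower and upper
points. -/
theorem Rel_iff_MulRel {p q r : Q.Space} : Rel p q r ↔ MulRel p q r := by
  rcases p.eq_low_or_eq_up with ⟨u, x, hx, rfl⟩ | ⟨u, x, hx, hx', hx'', rfl⟩ <;>
    rcases q.eq_low_or_eq_up with ⟨v, y, hy, rfl⟩ | ⟨v, y, hy, hy', hy'', rfl⟩
  · rcases r.eq_low_or_eq_up with ⟨w, z, hz, rfl⟩ | ⟨w, z, hz, hz', hz'', rfl⟩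
    · rw [Rel_low_low_low, MulRel_low_low_low]
    · rw [Rel_low_low_up, MulRel_low_low_up]
  · rcases r.eq_low_or_eq_up with ⟨w, z, hz, rfl⟩ | ⟨w, z, hz, hz', hz'', rfl⟩
    · exact iff_of_false not_Rel_low_up_low not_MulRel_low_up_low
    · rw [Rel_low_up_up, MulRel_low_up_up]
  · rw [Rel_comm, MulRel_comm]
    rcases r.eq_low_or_eq_up with ⟨w, z, hz, rfl⟩ | ⟨w, z, hz, hz', hz'', rfl⟩
    · exact iff_of_false not_Rel_low_up_low not_MulRel_low_up_low
    · rw [Rel_low_up_up, MulRel_low_up_up]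
  · exact iff_of_false not_Rel_up_up not_MulRel_up_up

/-! ### Prime filters of the lattice of the sets `W U V` -/

theorem subset_of_low_of_up {A B : Set Q.Space} (hlow : ∀ u x h, low u x h ∈ A → low u x h ∈ B)
    (hup : ∀ u x h hΔ hx, up u x h hΔ hx ∈ A → up u x h hΔ hx ∈ B) : A ⊆ B := by
  intro t ht
  rcases t.eq_low_or_eq_up with ⟨u, x, hx, rfl⟩ | ⟨u, x, hx, hx', hx'', rfl⟩
  · exact hlow _ _ _ ht
  · exact hup _ _ _ _ _ ht

/-- A prime filter of the lattice of the sets `W U V` is given by a point. -/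
theorem exists_point (M : Clopens S → Ups X → Prop)
    (hsub : ∀ {U V U' V'}, (W U V : Set Q.Space) ⊆ W U' V' → M U V → M U' V')
    (hinter : ∀ {U V U' V' U'' V''}, (W U V ∩ W U' V' : Set Q.Space) ⊆ W U'' V'' →
      M U V → M U' V' → M U'' V'')
    (hunion : ∀ {U V U' V' U'' V''}, (W U'' V'' : Set Q.Space) ⊆ W U V ∪ W U' V' →
      M U'' V'' → M U V ∨ M U' V')
    (htop : M ⊤ 1) (hbot : ¬ M ⊥ 1) : ∃ t : Q.Space, ∀ U V, M U V ↔ t ∈ W U V := by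
  have hcompl : ∀ U, M U 1 ∨ M Uᶜ 1 := fun U =>
    hunion (subset_of_low_of_up
      (fun u x h _ => (em (u ∈ U)).imp (fun h => ⟨h, trivial⟩) fun h => ⟨h, trivial⟩)
      (fun u x h _ _ _ => (em (u ∈ U)).imp (fun h => up_mem_W.2 (Or.inl h))
        fun h => up_mem_W.2 (Or.inl h))) htop
  have hinf : ∀ U V, M U 1 → M V 1 → M (U ⊓ V) 1 := fun U V =>
    hinter (subset_of_low_of_up (fun u x h hm => ⟨⟨hm.1.1, hm.2.1⟩, trivial⟩)
      (fun u x h _ _ hm => up_mem_W.2 (Or.inl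
        ⟨(up_mem_W.1 hm.1).resolve_right fun h => h trivial,
          (up_mem_W.1 hm.2).resolve_right fun h => h trivial⟩)))
  -- The sets `U` with `M U 1` form an ultrafilter of clopen sets, whose limit is the first
  -- coordinate.
  obtain ⟨u, hu⟩ : ∃ u, ∀ U, M U 1 ↔ u ∈ U := by
    obtain ⟨u, hu⟩ : ∃ u, ∀ U, M U 1 → u ∈ U := by
      by_contra! hn
      obtain ⟨U, hU, h⟩ := IsExternalJoin.exists_le_compl htop hinf ⊤ fun u _ =>
        (hn u).imp fun _ h => h.symm
      rw [compl_top, le_bot_iff] at hU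
      exact hbot (hU ▸ h)
    exact ⟨u, fun U => ⟨hu U, fun h => (hcompl U).resolve_right fun h' => hu _ h' h⟩⟩
  -- The sets `W ⊥ V` consist of upper points, so this decides the half in which the point lies. In
  -- the upper half `y` is determined by `y ∈ V ↔ ¬ M ⊥ V`.
  by_cases hlow : ∃ V, M ⊥ V
  · obtain ⟨V₀, hV₀⟩ := hlow
    have hbotsub : ∀ {V V' : Ups X}, (∀ x, Q.Δ x = x → x ∈ V'.carrier → x ∈ V.carrier) →
        M ⊥ V → M ⊥ V' := fun h => hsub (U := ⊥) <| subset_of_low_of_up (fun u x _ hm => hm.1.elim)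
      fun u x _ hΔ _ hm => up_mem_W.2 <| (up_mem_W.1 hm).imp_right fun hm hx => hm (h x hΔ hx)
    obtain ⟨y, hy⟩ := Ups.exists_point {V | ¬ M ⊥ V} ⟨1, hbot⟩
      (fun V hV V' hle hV' => hV (hbotsub (fun _ _ h => hle h) hV'))
      (fun V hV V' hV' h => (hunion (U'' := ⊥) (subset_of_low_of_up (fun u x _ hm => hm.1.elim)
        fun u x _ hΔ _ hm => by
          simp only [Set.mem_union, up_mem_W, Ups.mem_inf] at hm ⊢
          tauto) h).elim hV hV')
      (by
        intro V V' h
        by_contra! hn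
        simp only [Set.mem_ofPred_eq, not_not] at hn
        refine h (hinter (U := ⊥) (subset_of_low_of_up (fun u x _ hm => hm.1.1.elim)
          fun u x _ hΔ _ hm => ?_) hn.1 hn.2)
        simp only [Set.mem_inter_iff, up_mem_W, Ups.mem_sup] at hm ⊢
        tauto)
    have hy : ∀ V : Ups X, y ∈ V.carrier ↔ ¬ M ⊥ V := hy
    have htop : y ≠ ⊤ := fun h => (hy V₀).1 (h ▸ V₀.top_mem) hV₀
    -- Upper points have closed second coordinate, so `W ⊥ V` and `W ⊥ (δ V)` coincide.
    have hΔ : Q.Δ y = y := Ups.eq_of_forall_mem_iff fun V => by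
      rw [← mem_δ, hy, hy, not_iff_not]
      constructor <;> refine hbotsub fun x hx => ?_ <;> rw [mem_δ, hx] <;> exact id
    have hfix : Q.Fixes u y := fun U hU => Ups.eq_of_forall_mem_iff fun V => by
      rw [← mem_ν, hy, hy, not_iff_not]
      refine ⟨hsub (U := ⊥) <| subset_of_low_of_up (fun u x _ hm => hm.1.elim)
        fun v x hx _ _ hm => ?_,
        fun h => hinter (U := ⊥) (subset_of_low_of_up (fun u x _ hm => hm.1.1.elim)
          fun v x hx _ _ hm => ?_) h ((hcompl U).resolve_left fun h => hU ((hu U).1 h))⟩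
      · rw [up_mem_W, hx.mem_ν] at hm
        rw [up_mem_W]
        tauto
      · rw [Set.mem_inter_iff, up_mem_W, up_mem_W, IsExternalJoin.mem_compl] at hm
        rw [up_mem_W, hx.mem_ν]
        have := Ups.mem_one (x := x)
        tauto
    refine ⟨up u y hfix hΔ htop, fun U V => ?_⟩
    rw [up_mem_W, hy, not_not, ← hu]
    constructor
    -- Here `W U V ⊆ W U 1 ∪ W ⊥ V`; the converse uses `W U 1 ∩ W ⊥ V₀ ⊆ W U V`, where `W ⊥ V₀`
    -- discards the lower points.
    · refine hunion (subset_of_low_of_up (fun v x hx hm => Or.inl ⟨hm.1, trivial⟩)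
        fun v x hx _ _ hm => ?_)
      rw [Set.mem_union, up_mem_W, up_mem_W]
      rw [up_mem_W] at hm
      tauto
    · rintro (h | h)
      · refine hinter (U' := ⊥) (subset_of_low_of_up (fun v x hx hm => hm.2.1.elim)
          fun v x hx _ _ hm => ?_) h hV₀
        rw [Set.mem_inter_iff, up_mem_W, up_mem_W] at hm
        rw [up_mem_W]
        have := Ups.mem_one (x := x)
        tauto
      · exact hsub (U := ⊥) (subset_of_low_of_up (fun v x hx hm => hm.1.elim) fun v x hx _ _ hm =>
          up_mem_W.2 (Or.inr ((up_mem_W.1 hm).resolve_left fun h => h))) h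
  -- In the lower half `x` is determined by `x ∈ V ↔ M ⊤ V`. Each `W ⊤ V` contains all upper points,
  -- so inclusions between such sets only concern lower ones.
  · have hup : ∀ {U v x hx hΔ hx'}, v ∈ U → up v x hx hΔ hx' ∈ (W U 1 : Set Q.Space) :=
      fun h => up_mem_W.2 (Or.inl h)
    have hup_top : ∀ {v x hx hΔ hx' V}, up v x hx hΔ hx' ∈ (W ⊤ V : Set Q.Space) :=
      up_mem_W.2 (Or.inl trivial)
    have htopsub : ∀ {V V' : Ups X}, V ≤ V' → M ⊤ V → M ⊤ V' := fun h => hsub <|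
      subset_of_low_of_up (fun u x _ hm => ⟨trivial, h hm.2⟩) fun _ _ _ _ _ _ => hup_top
    obtain ⟨x, hx⟩ := Ups.exists_point {V | M ⊤ V} ⟨1, htop⟩
      (fun V hV V' hle => htopsub hle hV)
      (fun V hV V' hV' => hinter (subset_of_low_of_up
        (fun u x _ hm => ⟨trivial, hm.1.2, hm.2.2⟩) fun _ _ _ _ _ _ => hup_top) hV hV')
      (fun V V' => hunion (subset_of_low_of_up
        (fun u x _ hm => hm.2.imp (fun h => ⟨trivial, h⟩) fun h => ⟨trivial, h⟩)
        fun _ _ _ _ _ _ => Or.inl hup_top))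
    have hx : ∀ V : Ups X, x ∈ V.carrier ↔ M ⊤ V := hx
    have hfix : Q.Fixes u x := fun U hU => Ups.eq_of_forall_mem_iff fun V => by
      rw [← mem_ν, hx, hx]
      refine ⟨fun h => (hunion (subset_of_low_of_up (fun v x hx hm => ?_)
        fun _ _ _ _ _ _ => Or.inl hup_top) h).resolve_right fun h => hU ((hu U).1 h), hsub <|
          subset_of_low_of_up (fun v x hx hm => ?_) fun _ _ _ _ _ _ => hup_top⟩
      · exact (hx.mem_ν.1 hm.2).symm.imp (fun h => ⟨trivial, h⟩) fun h => ⟨h, trivial⟩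
      · exact ⟨trivial, hx.mem_ν.2 (Or.inr hm.2)⟩
    refine ⟨low u x hfix, fun U V => ?_⟩
    rw [low_mem_W, hx, ← hu]
    constructor
    · refine fun h => ⟨(hunion (U := U) (V := 1) (U' := ⊥) (V' := V) (subset_of_low_of_up
        (fun v x hx hm => Or.inl ⟨hm.1, trivial⟩) fun v x hx _ _ hm => ?_) h).resolve_right
          fun h => hlow ⟨V, h⟩, hsub (subset_of_low_of_up (fun v x hx hm => ⟨trivial, hm.2⟩)
            fun _ _ _ _ _ _ => hup_top) h⟩
      exact (up_mem_W.1 hm).imp hup fun h => up_mem_W.2 (Or.inr h)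
    · rintro ⟨h, h'⟩
      exact hinter (V := 1) (subset_of_low_of_up (fun v x hx hm => ⟨hm.1.1, hm.2.2⟩)
        fun v x hx _ _ hm => up_mem_W.2 (Or.inl
          ((up_mem_W.1 hm.1).resolve_right fun h => h trivial))) h h'

end Space
end DualQuadruple
end MTLDuality

namespace MTLDuality
open GMTLAlgebra TopologicalSpace

/-! ## The isomorphism of `S ⊗ X` with the dual of `B ⊗ₑ^δ A` -/

namespace IsTensor
open DualQuadruple Space

variable {S : Type u} {X : Type v}
  [TopologicalSpace S] [CompactSpace S] [T2Space S] [TotallyDisconnectedSpace S]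
  [TopologicalSpace X] [PartialOrder X] [OrderTop X] [GMTLSpace X]
  {Q : DualQuadruple S X} {L : Type*} [SBPAlgebra L] {q : Clopens S × Ups X → L}
  (hq : IsTensor Q.ν Q.δ q)
include hq

theorem apply_eq_iff {U V U' V'} :
    q (U, V) = q (U', V') ↔ (W U V : Set Q.Space) = W U' V' := by
  rw [hq.eq_iff, W_eq_iff]

theorem apply_inf_eq {U V U' V' U'' V''} : q (U, V) ⊓ q (U', V') = q (U'', V'') ↔
    (W U V ∩ W U' V' : Set Q.Space) = W U'' V'' := by
  rw [hq.map_inf, hq.apply_eq_iff, W_inter]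

theorem apply_le_iff {U V U' V'} :
    q (U, V) ≤ q (U', V') ↔ (W U V : Set Q.Space) ⊆ W U' V' := by
  rw [← inf_eq_left, hq.apply_inf_eq, Set.inter_eq_left]

theorem apply_inf_le_iff {U V U' V' U'' V''} : q (U, V) ⊓ q (U', V') ≤ q (U'', V'') ↔
    (W U V ∩ W U' V' : Set Q.Space) ⊆ W U'' V'' := by
  rw [hq.map_inf, hq.apply_le_iff, W_inter]

theorem apply_le_sup_iff {U V U' V' U'' V''} : q (U'', V'') ≤ q (U, V) ⊔ q (U', V') ↔
    (W U'' V'' : Set Q.Space) ⊆ W U V ∪ W U' V' := by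
  rw [hq.map_sup, hq.apply_le_iff, W_union]

theorem exists_apply_eq (l : L) : ∃ U V, q (U, V) = l :=
  let ⟨⟨U, V⟩, h⟩ := hq.surjective l
  ⟨U, V, h⟩

omit hq in
/-- The set of the classes `[U, V]` for which `t ∈ W U V`. -/
def classes (q : Clopens S × Ups X → L) (t : Q.Space) : Set L :=
  {l | ∃ U V, q (U, V) = l ∧ t ∈ W U V}

theorem apply_mem_classes {U V} {t : Q.Space} : q (U, V) ∈ classes q t ↔ t ∈ W U V :=
  ⟨fun ⟨_, _, h, ht⟩ => (hq.apply_eq_iff.1 h).subset ht, fun h => ⟨U, V, rfl, h⟩⟩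

theorem isPFilter_classes (t : Q.Space) : Order.IsPFilter (classes q t) := by
  refine Order.IsPFilter.of_def ⟨q (⊤, 1), ?_⟩ ?_ ?_
  · rw [hq.apply_mem_classes, W_top_one]; trivial
  · rintro _ ⟨U, V, rfl, h⟩ _ ⟨U', V', rfl, h'⟩
    refine ⟨q (U, V) ⊓ q (U', V'), ?_, inf_le_left, inf_le_right⟩
    rw [hq.map_inf, hq.apply_mem_classes, ← W_inter]
    exact ⟨h, h'⟩
  · rintro x y hxy ⟨U, V, rfl, h⟩
    obtain ⟨U', V', rfl⟩ := hq.exists_apply_eq y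
    exact ⟨U', V', rfl, hq.apply_le_iff.1 hxy h⟩

theorem isIdeal_compl_classes (t : Q.Space) : Order.IsIdeal (classes q t)ᶜ where
  IsLowerSet x y hyx hx hy := by
    obtain ⟨U, V, rfl⟩ := hq.exists_apply_eq x
    obtain ⟨U', V', rfl⟩ := hq.exists_apply_eq y
    rw [hq.apply_mem_classes] at hy
    exact hx ⟨U, V, rfl, hq.apply_le_iff.1 hyx hy⟩
  Nonempty := ⟨q (⊥, 1), by
    rw [Set.mem_compl_iff, hq.apply_mem_classes, W_bot_one]
    exact fun h => h⟩
  Directed := by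
    intro x hx y hy
    obtain ⟨U, V, rfl⟩ := hq.exists_apply_eq x
    obtain ⟨U', V', rfl⟩ := hq.exists_apply_eq y
    refine ⟨q (U, V) ⊔ q (U', V'), ?_, le_sup_left, le_sup_right⟩
    rw [Set.mem_compl_iff, hq.apply_mem_classes] at hx hy
    rw [hq.map_sup, Set.mem_compl_iff, hq.apply_mem_classes, ← W_union]
    exact fun h => h.elim hx hy

/-- The prime filter given by a point of `S ⊗ X`. -/
def toDual (t : Q.Space) : DualSpace L :=
  ⟨(hq.isPFilter_classes t).toPFilter, ⟨hq.isIdeal_compl_classes t⟩⟩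

theorem apply_mem_toDual {U V} {t : Q.Space} : q (U, V) ∈ (hq.toDual t).1 ↔ t ∈ W U V :=
  hq.apply_mem_classes

theorem toDual_le_toDual {s t : Q.Space} : hq.toDual s ≤ hq.toDual t ↔ s ≤ t := by
  rw [le_iff_forall_mem_W]
  constructor
  · intro h U V hs
    exact hq.apply_mem_toDual.1 (h (hq.apply_mem_toDual.2 hs))
  · intro h l hl
    obtain ⟨U, V, rfl⟩ := hq.exists_apply_eq l
    exact hq.apply_mem_toDual.2 (h U V (hq.apply_mem_toDual.1 hl))

theorem toDual_injective : Function.Injective hq.toDual := fun _ _ h =>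
  le_antisymm (hq.toDual_le_toDual.1 h.le) (hq.toDual_le_toDual.1 h.ge)

theorem toDual_surjective : Function.Surjective hq.toDual := by
  rintro ⟨F, hF⟩
  have hI := hF.compl_ideal
  have hinf : ∀ {a b c : L}, a ⊓ b ≤ c → a ∈ F → b ∈ F → c ∈ F := fun h ha hb => by
    obtain ⟨d, hd, hda, hdb⟩ := F.directed _ ha _ hb
    exact Order.PFilter.mem_of_le ((le_inf hda hdb).trans h) hd
  have hsup : ∀ {a b c : L}, c ≤ a ⊔ b → c ∈ F → a ∈ F ∨ b ∈ F := fun h hc => by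
    by_contra! hn
    obtain ⟨d, hd, hda, hdb⟩ := hI.Directed _ hn.1 _ hn.2
    exact hd (Order.PFilter.mem_of_le (h.trans (sup_le hda hdb)) hc)
  obtain ⟨t, ht⟩ := Space.exists_point (Q := Q) (fun U V => q (U, V) ∈ F)
    (fun h => Order.PFilter.mem_of_le (hq.apply_le_iff.2 h))
    (fun h => hinf (hq.apply_inf_le_iff.2 h))
    (fun h => hsup (hq.apply_le_sup_iff.2 h))
    (by
      obtain ⟨a, ha⟩ := F.nonempty
      exact Order.PFilter.mem_of_le ((le_one a).trans hq.map_one.ge) ha)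
    (fun h => by
      obtain ⟨a, ha⟩ := hI.Nonempty
      exact ha (Order.PFilter.mem_of_le (hq.map_bot.trans_le bot_le) h))
  refine ⟨t, Subtype.ext (SetLike.ext fun l => ?_)⟩
  obtain ⟨U, V, rfl⟩ := hq.exists_apply_eq l
  exact hq.apply_mem_toDual.trans (ht U V).symm

/-- The preimage of `φ [U, V]` is `W U V`, so the two subbases correspond. For a bijection this
already yields a homeomorphism. -/
theorem isInducing_toDual : Topology.IsInducing hq.toDual where
  eq_induced := by
    refine Eq.trans ?_ (induced_generateFrom_eq (f := hq.toDual)).symm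
    refine congrArg TopologicalSpace.generateFrom (Set.ext fun s => ?_)
    have hpre : ∀ U V, hq.toDual ⁻¹' DualSpace.φ (q (U, V)) = W U V := fun U V =>
      Set.ext fun t => hq.apply_mem_toDual
    constructor
    · rintro ⟨U, V, rfl | rfl⟩
      · exact ⟨_, ⟨q (U, V), Or.inl rfl⟩, hpre U V⟩
      · exact ⟨_, ⟨q (U, V), Or.inr rfl⟩, by rw [Set.preimage_compl, hpre]⟩
    · rintro ⟨_, ⟨l, h⟩, rfl⟩
      obtain ⟨U, V, rfl⟩ := hq.exists_apply_eq l
      rcases h with rfl | rfl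
      · exact ⟨U, V, Or.inl (hpre U V)⟩
      · exact ⟨U, V, Or.inr (by rw [Set.preimage_compl, hpre])⟩

theorem Rel_toDual {s t r : Q.Space} :
    DualSpace.Rel (hq.toDual s) (hq.toDual t) (hq.toDual r) ↔ Space.Rel s t r := by
  rw [Rel_iff_MulRel]
  constructor
  · intro h U V U' V' hs ht
    rw [← hq.apply_mem_toDual, mulSnd, ← hq.map_mul]
    exact h ⟨_, hq.apply_mem_toDual.2 hs, _, hq.apply_mem_toDual.2 ht, le_rfl⟩
  · rintro h c ⟨a, ha, b, hb, hab⟩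
    obtain ⟨U, V, rfl⟩ := hq.exists_apply_eq a
    obtain ⟨U', V', rfl⟩ := hq.exists_apply_eq b
    refine Order.PFilter.mem_of_le hab ?_
    rw [hq.map_mul]
    exact hq.apply_mem_toDual.2 (h U V U' V' (hq.apply_mem_toDual.1 ha) (hq.apply_mem_toDual.1 hb))

/-- `S ⊗ X` is isomorphic to the extended Priestley dual of `B ⊗ₑ^δ A`. -/
noncomputable def dualIso : DualIso Q L where
  toHomeomorph := (Equiv.ofBijective hq.toDual
    ⟨hq.toDual_injective, hq.toDual_surjective⟩).toHomeomorphOfIsInducing hq.isInducing_toDual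
  map_le _ _ := hq.toDual_le_toDual.symm
  map_Rel _ _ _ := hq.Rel_toDual.symm
  map_unit t := iff_of_true trivial (by
    change (1 : L) ∈ (hq.toDual t).1
    rw [← hq.map_one, hq.apply_mem_toDual, W_top_one]
    trivial)

end IsTensor
end MTLDuality

open MTLDuality
theorem mainTheorem1 {S : Type u} {X : Type v}
    [TopologicalSpace S] [CompactSpace S] [T2Space S] [TotallyDisconnectedSpace S]
    [TopologicalSpace X] [PartialOrder X] [OrderTop X] [GMTLSpace X]
    (Q : DualQuadruple S X) :
    ∃ (L : Type (max u v)) (_ : SBPAlgebra L),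
      (∃ q : TopologicalSpace.Clopens S × Ups X → L, IsTensor Q.ν Q.δ q) ∧
      Nonempty (DualIso Q L) := by
  obtain ⟨L, inst, q, hq⟩ := Q.isExternalJoin.exists_isTensor Q.δ
  exact ⟨L, inst, ⟨q, hq⟩, ⟨hq.dualIso⟩⟩
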